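/- All graphs are finite and simple. A graph is asymmetric if its only automorphism is the identity, and Hamiltonian if it has a cycle through all its vertices. For every integer $k\ge 3$ there is a $k$-regular asymmetric Hamiltonian graph. More precisely, the following hold. For even $n\ge 12$ let $C(n)$ be the graph on $v_1,\dots,v_n$ (indices modulo $n$) whose edges are those of the cycle $v_1v_2\cdots v_nv_1$, the edges $v_nv_{n/2-1}$, $v_1v_{n-2}$, $v_{n-1}v_{n-3}$, and the edges $v_kv_{n-2-k}$ for $2\le k\le \frac n2-2$. Let $Q(n)$ be obtained from $C(n)$ by adding, if $n\equiv 0 \pmod 4$, the edges $v_{n/4}v_{3n/4}$ and $v_{n/4+i}v_{n/4-i}$ for $1\le i\le \frac n2-1$, and, if $n\equiv 2\pmod 4$, the edges $v_1v_{n/2+1}$ and $v_{1+i}v_{1-i}$ for $1\le i\le \frac n2-1$. (1) For every even $n\ge 12$, $C(n)$ is a $3$-regular and $Q(n)$ a $4$-regular asymmetric Hamiltonian graph; the complement of $C(n)$ is an $(n-4)$-regular asymmetric Hamiltonian graph and the complement of $Q(n)$ is an $(n-5)$-regular asymmetric Hamiltonian graph (so that all even $k\ge 8$ and all odd $k\ge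 7$ are covered). (2) More generally, the complement of any $3$-regular asymmetric Hamiltonian graph on $n\ge 8$ vertices is an $(n-4)$-regular asymmetric Hamiltonian graph, and the complement of any $4$-regular asymmetric Hamiltonian graph on $n\ge 10$ vertices is an $(n-5)$-regular asymmetric Hamiltonian graph. (3) There is a $5$-regular asymmetric Hamiltonian graph on $12$ vertices whose complement is a $6$-regular asymmetric Hamiltonian graph. -/

import Mathlib

/-- A graph is asymmetric if the identity is its only automorphism. -/
def SimpleGraph.IsAsymmetric {V : Type*} (G : SimpleGraph V) : Prop :=
  ∀ σ : G ≃g G, ∀ v : V, σ v = v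

open Classical in
/-- `G` is a `k`-regular asymmetric Hamiltonian graph (on a finite vertex set). -/
structure SimpleGraph.IsRegularAsymmetricHamiltonian {V : Type*} [Fintype V]
    (G : SimpleGraph V) (k : ℕ) : Prop where
  regular : G.IsRegularOfDegree k
  asymmetric : G.IsAsymmetric
  hamiltonian : G.IsHamiltonian

/-- The edges, as unordered pairs `{v_x, v_y}` listed in one order, of the cubic graph on `n`
vertices `v_1, …, v_n`; the vertex `v_j` is the residue of `j` modulo `n`, so `v_n` is `0`. -/
def cubicRel (n : ℕ) (x y : Fin n) : Prop :=
  -- the cycle `v_1 v_2 … v_n v_1`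
  y.val = (x.val + 1) % n ∨
  -- `v_n v_{n/2-1}`
  (x.val = 0 ∧ y.val = n / 2 - 1) ∨
  -- `v_1 v_{n-2}`
  (x.val = 1 ∧ y.val = n - 2) ∨
  -- `v_{n-1} v_{n-3}`
  (x.val = n - 1 ∧ y.val = n - 3) ∨
  -- `v_k v_{n-2-k}` for `2 ≤ k ≤ n/2-2`
  (∃ k : ℕ, 2 ≤ k ∧ k ≤ n / 2 - 2 ∧ x.val = k ∧ y.val = n - 2 - k)

/-- The cubic graph on `n` vertices (meaningful for even `n ≥ 12`). -/
def cubicGraph (n : ℕ) : SimpleGraph (Fin n) :=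
  SimpleGraph.fromRel (cubicRel n)

/-- The edges added to the cubic graph on `n` vertices to obtain the quartic one, with the same
labelling of the vertices by residues modulo `n`. -/
def quarticExtraRel (n : ℕ) (x y : Fin n) : Prop :=
  -- for `n ≡ 0 (mod 4)`: `v_{n/4} v_{3n/4}`, and `v_{n/4+i} v_{n/4-i}` for `1 ≤ i ≤ n/2-1`
  (n % 4 = 0 ∧
    ((x.val = n / 4 ∧ y.val = 3 * n / 4) ∨
      ∃ i : ℕ, 1 ≤ i ∧ i ≤ n / 2 - 1 ∧
        x.val = (n / 4 + i) % n ∧ y.val = (n + n / 4 - i) % n)) ∨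
  -- for `n ≡ 2 (mod 4)`: `v_1 v_{n/2+1}`, and `v_{1+i} v_{1-i}` for `1 ≤ i ≤ n/2-1`
  (n % 4 = 2 ∧
    ((x.val = 1 ∧ y.val = n / 2 + 1) ∨
      ∃ i : ℕ, 1 ≤ i ∧ i ≤ n / 2 - 1 ∧
        x.val = (1 + i) % n ∧ y.val = (n + 1 - i) % n))

/-- The quartic graph on `n` vertices (meaningful for even `n ≥ 12`). -/
def quarticGraph (n : ℕ) : SimpleGraph (Fin n) :=
  SimpleGraph.fromRel (fun x y => cubicRel n x y ∨ quarticExtraRel n x y)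

/-! Write `n = 2m` and let the residue `0` stand for `v_n`. Hamiltonicity of the cubic graph, and of
any graph containing it, is immediate from the cycle `0, 1, …, n - 1`. For complements it follows
from Dirac's theorem, proved here by an extremal argument: the complement of a `k`-regular graph has
degree `n - 1 - k`, which is at least `n / 2` when `2k + 2 ≤ n`. This gives the bounds `8` for `k =
3` and `10` for `k = 4`, and covers `k = 5` on twelve vertices. A graph and its complement have the
same automorphisms.

The substance is asymmetry. Triangles are invariant and few, so they pin down a small seed of fixed
vertices. Fixedness then spreads: a vertex is fixed when it is the only neighbour of a fixed vertex,
or the only common neighbour of two, not already known to be fixed (`IsRelAut.fixed_of_adj`,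
`IsRelAut.fixed_of_common`).

Cubic graph: there are two triangles, and `0` is the only vertex outside them with neighbours in
both (`cubicAdj_fixed_zero`); the rungs `x`, `n - 2 - x` then carry fixedness along the ladder.

Quartic graph: a perfect matching is added whose edges are the orbits of a reflection of the cycle,
together with the edge joining its two fixed points. For `n = 4h` the seed is a fan of three
triangles around `2h - 1` (`evenQuarticAdj_fan`); for odd `m` it is two triangles meeting only in
`m` (`oddQuarticAdj_bowtie`).

The descriptions of triangles and neighbourhoods need `n ≥ 16` for the fan and `n ≥ 18` for the
bowtie. The quartic graphs on 12 and 14 vertices and the quintic one are settled by computing an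
invariant vertex colouring that separates all vertices. -/

namespace SimpleGraph

variable {V : Type*} {G : SimpleGraph V}

/-! ### Hamiltonian cycles from cyclic orderings -/

theorem isHamiltonian_of_cyclic_enumeration [Fintype V] [DecidableEq V] {n : ℕ} (hn : 3 ≤ n)
    (hcard : Fintype.card V = n) (f : Fin n → V) (hf : Function.Injective f)
    (hadj : ∀ i j : Fin n, j.val = (i.val + 1) % n → G.Adj (f i) (f j)) :
    G.IsHamiltonian := by
  intro _
  -- Adjacency in `cycleGraph` is phrased with subtraction in `Fin n`; this converts it to the
  -- successor form of `hadj`.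
  have key : ∀ u v : Fin n, (u - v).val = 1 → u.val = (v.val + 1) % n := by
    intro u v h
    rw [Fin.sub_def] at h
    have hu := u.isLt
    have hv := v.isLt
    simp only at h
    by_cases hc : n - v.val + u.val < n
    · rw [Nat.mod_eq_of_lt hc] at h
      have : u.val = 0 ∧ v.val + 1 = n := by omega
      rw [this.2, this.1, Nat.mod_self]
    · rw [Nat.mod_eq_sub_mod (by omega), Nat.mod_eq_of_lt (by omega)] at h
      rw [Nat.mod_eq_of_lt (by omega)]
      omega
  have hcon : cycleGraph n ⊑ G := by
    refine ⟨Hom.toCopy ⟨f, ?_⟩ hf⟩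
    intro u v huv
    rcases cycleGraph_adj'.mp huv with h | h
    · exact (hadj _ _ (key _ _ h)).symm
    · exact hadj _ _ (key _ _ h)
  obtain ⟨v, p, hp, hl⟩ := (cycleGraph_isContained_iff (by omega)).mp hcon
  exact ⟨v, p, Walk.isHamiltonianCycle_iff_isCycle_and_length_eq.mpr ⟨hp, hl.trans hcard.symm⟩⟩

open Classical in
theorem isHamiltonian_of_isChain [Fintype V] (hV : 3 ≤ Fintype.card V) (a : V) (t : List V)
    (hnd : (a :: t).Nodup) (hlen : (a :: t).length = Fintype.card V)
    (hchain : List.IsChain G.Adj (a :: t ++ [a])) : G.IsHamiltonian := by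
  refine isHamiltonian_of_cyclic_enumeration hV rfl
    (fun i => (a :: t)[i.val]'(by rw [hlen]; exact i.isLt)) ?_ ?_
  · intro i j hij
    exact Fin.ext ((List.Nodup.getElem_inj_iff hnd).mp hij)
  · intro i j hij
    have hi := i.isLt
    rw [List.isChain_iff_getElem] at hchain
    have hlen' : (a :: t ++ [a]).length = Fintype.card V + 1 := by
      rw [List.length_append, hlen]; rfl
    have h := hchain i.val (by omega)
    rw [List.getElem_append_left (by omega)] at h
    by_cases hc : i.val + 1 < Fintype.card V
    · rw [List.getElem_append_left (by omega)] at h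
      rw [Nat.mod_eq_of_lt hc] at hij
      simpa only [hij] using h
    · have hi' : i.val + 1 = Fintype.card V := by omega
      rw [List.getElem_append_right (by omega)] at h
      rw [hi', Nat.mod_self] at hij
      simpa [hij] using h

/-! ### Dirac's theorem -/

/-- The number of consecutive pairs of a list that are related by `r`. -/
def _root_.List.countConsecutive {α : Type*} (r : α → α → Prop) [DecidableRel r] : List α → ℕ
  | a :: b :: l => (if r a b then 1 else 0) + List.countConsecutive r (b :: l)
  | _ => 0

section countConsecutive

variable {α : Type*} (r : α → α → Prop) [DecidableRel r]

/-- The cut element `a` is kept in both pieces, so no consecutive pair is lost or counted twice. -/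
theorem _root_.List.countConsecutive_append (X : List α) (a : α) (Y : List α) :
    (X ++ a :: Y).countConsecutive r =
      (X ++ [a]).countConsecutive r + (a :: Y).countConsecutive r := by
  induction X with
  | nil => simp [List.countConsecutive]
  | cons b X ih =>
    cases X with
    | nil => simp [List.countConsecutive]
    | cons c X =>
      simp only [List.cons_append, List.countConsecutive] at ih ⊢
      omega

theorem _root_.List.countConsecutive_reverse (hr : ∀ a b, r a b → r b a) (X : List α) :
    X.reverse.countConsecutive r = X.countConsecutive r := by
  induction X with
  | nil => rfl
  | cons a X ih =>
    cases X with
    | nil => rfl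
    | cons b X =>
      rw [List.reverse_cons, List.reverse_cons, List.append_assoc, List.singleton_append,
        List.countConsecutive_append, ← List.reverse_cons, ih]
      have : r b a ↔ r a b := ⟨hr b a, hr a b⟩
      simp only [List.countConsecutive, this]
      omega

theorem _root_.List.countConsecutive_le (X : List α) : X.countConsecutive r ≤ X.length := by
  induction X with
  | nil => simp [List.countConsecutive]
  | cons a X ih =>
    cases X with
    | nil => simp [List.countConsecutive]
    | cons b X =>
      simp only [List.countConsecutive, List.length_cons] at ih ⊢
      split_ifs <;> omega

/-- The number of cyclically consecutive pairs of a list that are related by `r`. -/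
def _root_.List.countCyclic : List α → ℕ
  | [] => 0
  | a :: t => (a :: t ++ [a]).countConsecutive r

/-- Used only for boundedness, so that an enumeration with the maximal count exists. -/
theorem _root_.List.countCyclic_le (X : List α) : X.countCyclic r ≤ X.length + 1 := by
  cases X with
  | nil => simp [List.countCyclic]
  | cons a t => exact (List.countConsecutive_le r _).trans (by simp)

theorem _root_.List.countCyclic_rotate (a : α) (X : List α) (b : α) (Y : List α) :
    (b :: Y ++ a :: X).countCyclic r = (a :: X ++ b :: Y).countCyclic r := by
  have h1 := List.countConsecutive_append r (a :: X) b (Y ++ [a])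
  have h2 := List.countConsecutive_append r (b :: Y) a (X ++ [b])
  simp only [List.countCyclic, List.cons_append, List.append_assoc] at h1 h2 ⊢
  omega

end countConsecutive

open Classical in
/-- A list enumerating all vertices, starting at `y` and ending at `x`, in which some neighbour of
`x` is immediately followed by a neighbour of `y`. -/
theorem exists_crossing [Fintype V] (hdeg : ∀ v, Fintype.card V ≤ 2 * G.degree v)
    (y x : V) (M : List V) (hnd : (y :: M ++ [x]).Nodup)
    (hlen : (y :: M ++ [x]).length = Fintype.card V) :
    ∃ (A : List V) (p q : V) (B : List V), y :: M ++ [x] = A ++ p :: q :: B ∧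
      G.Adj x p ∧ G.Adj y q := by
  set l := y :: M ++ [x] with hl
  have hmem : ∀ v, v ∈ l := by
    intro v
    have h : l.toFinset = Finset.univ := by
      apply Finset.eq_univ_of_card
      rw [List.toFinset_card_of_nodup hnd, hlen]
    exact List.mem_toFinset.mp (h ▸ Finset.mem_univ v)
  have hidx : ∀ v, l.idxOf v < l.length := fun v => List.idxOf_lt_length_of_mem (hmem v)
  have hy0 : ∀ v, v ≠ y → l.idxOf v ≠ 0 := by
    intro v hv h
    apply hv
    have h1 := List.getElem_idxOf (hidx v)
    simp only [h] at h1
    rw [← h1]; simp [hl]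
  have hxl : ∀ v, v ≠ x → l.idxOf v ≠ l.length - 1 := by
    intro v hv h
    apply hv
    have h1 := List.getElem_idxOf (hidx v)
    simp only [h] at h1
    rw [← h1]; simp [hl]
  -- `I` holds the positions just before neighbours of `y`, and `J` the positions of neighbours of
  -- `x`. As `y` is first and `x` last, both lie in `range (l.length - 1)`, while their sizes add up
  -- to at least `l.length`; hence they meet.
  let I := (G.neighborFinset y).image (fun v => l.idxOf v - 1)
  let J := (G.neighborFinset x).image (fun v => l.idxOf v)
  have hI : I.card = G.degree y := by
    rw [← card_neighborFinset_eq_degree]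
    apply Finset.card_image_of_injOn
    intro u hu v hv huv
    have hu' : G.Adj y u := by simpa using hu
    have hv' : G.Adj y v := by simpa using hv
    have h1 := hy0 u hu'.ne'
    have h2 := hy0 v hv'.ne'
    simp only at huv
    exact (List.idxOf_inj (hmem u)).mp (by omega)
  have hJ : J.card = G.degree x := by
    rw [← card_neighborFinset_eq_degree]
    apply Finset.card_image_of_injOn
    intro u _ v _ huv
    exact (List.idxOf_inj (hmem u)).mp huv
  have hpos : 0 < l.length := by simp [hl]
  obtain ⟨i, hi⟩ := Finset.inter_nonempty_of_card_lt_card_add_card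
    (s := Finset.range (l.length - 1)) (t := I) (u := J)
    (by
      intro i hi
      obtain ⟨v, hv, rfl⟩ := Finset.mem_image.mp hi
      have hv' : G.Adj y v := by simpa using hv
      have h1 := hy0 v hv'.ne'
      have h2 := hidx v
      rw [Finset.mem_range]; omega)
    (by
      intro i hi
      obtain ⟨v, hv, rfl⟩ := Finset.mem_image.mp hi
      have hv' : G.Adj x v := by simpa using hv
      have h1 := hxl v hv'.ne'
      have h2 := hidx v
      rw [Finset.mem_range]; omega)
    (by
      have h1 := hdeg x
      have h2 := hdeg y
      rw [hI, hJ, Finset.card_range]; omega)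
  rw [Finset.mem_inter] at hi
  obtain ⟨q, hq, hqi⟩ := Finset.mem_image.mp hi.1
  obtain ⟨p, hp, hpi⟩ := Finset.mem_image.mp hi.2
  have hq' : G.Adj y q := by simpa using hq
  have hp' : G.Adj x p := by simpa using hp
  have h1 := hy0 q hq'.ne'
  have h2 := hidx q
  have h3 := hidx p
  have h4 : l.idxOf q = l.idxOf p + 1 := by omega
  refine ⟨l.take (l.idxOf p), p, q, l.drop (l.idxOf p + 2), ?_, hp', hq'⟩
  have e1 := List.getElem_idxOf h3
  have e2 := List.getElem_idxOf h2
  simp only [h4] at e2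
  conv_lhs => rw [← List.take_append_drop (l.idxOf p) l]
  rw [List.drop_eq_getElem_cons h3, List.drop_eq_getElem_cons (by omega : l.idxOf p + 1 < l.length),
    e1, e2]

open Classical in
-- Pósa-style exchange: at a crossing `p, q`, reverse the final segment from `q` to `x`. The cyclic
-- pairs `pq` and `xy` are replaced by the edges `px` and `qy`; since `xy` was not an edge, the
-- count goes up.
theorem exists_countCyclic_lt [Fintype V] (hdeg : ∀ v, Fintype.card V ≤ 2 * G.degree v)
    (y x : V) (M : List V) (hnd : (y :: M ++ [x]).Nodup)
    (hlen : (y :: M ++ [x]).length = Fintype.card V) (hxy : ¬ G.Adj x y) :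
    ∃ l : List V, l.Nodup ∧ l.length = Fintype.card V ∧
      (y :: M ++ [x]).countCyclic G.Adj < l.countCyclic G.Adj := by
  obtain ⟨A, p, q, B, h, hp, hq⟩ := exists_crossing hdeg y x M hnd hlen
  -- If `p` were the first entry `y`, or `q` the last entry `x`, the crossing would make `x` and `y`
  -- adjacent. So both outer parts of the list are nonempty.
  cases A with
  | nil =>
    simp only [List.cons_append, List.nil_append, List.cons.injEq] at h
    exact absurd (h.1 ▸ hp) hxy
  | cons a A =>
    obtain ⟨rfl, h⟩ : y = a ∧ M ++ [x] = A ++ p :: q :: B := by simpa using h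
    rcases List.eq_nil_or_concat B with rfl | ⟨B, b, rfl⟩
    · have h' : M ++ [x] = (A ++ [p]) ++ [q] := by simpa using h
      have := (List.append_inj' h' rfl).2
      simp only [List.cons.injEq, and_true] at this
      exact absurd (this ▸ hq).symm hxy
    · have h' : M ++ [x] = (A ++ p :: q :: B) ++ [b] := by simpa using h
      obtain ⟨hM, hb⟩ := List.append_inj' h' rfl
      simp only [List.cons.injEq, and_true] at hb
      subst hb hM
      have hperm : (y :: (A ++ p :: q :: B) ++ [x]).Perm (y :: A ++ p :: x :: (B.reverse ++ [q])) := by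
        have : (q :: (B ++ [x])).Perm (x :: (B.reverse ++ [q])) := by
          have := List.reverse_perm (q :: (B ++ [x]))
          simpa using this.symm
        simpa using this.append_left (A ++ [p])
      refine ⟨y :: A ++ p :: x :: (B.reverse ++ [q]), hperm.nodup_iff.mp hnd,
        hperm.length_eq.symm.trans hlen, ?_⟩
      have c1 := List.countConsecutive_append G.Adj (y :: A) p (q :: (B ++ [x] ++ [y]))
      have c2 := List.countConsecutive_append G.Adj (q :: B) x [y]
      have c3 := List.countConsecutive_append G.Adj (y :: A) p (x :: (B.reverse ++ [q] ++ [y]))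
      have c4 := List.countConsecutive_append G.Adj (x :: B.reverse) q [y]
      have c5 := List.countConsecutive_reverse G.Adj (fun _ _ => Adj.symm) (q :: (B ++ [x]))
      have hp' : G.Adj p x := hp.symm
      have hq' : G.Adj q y := hq.symm
      simp only [List.countCyclic, List.cons_append, List.append_assoc, List.nil_append,
        List.countConsecutive, List.reverse_cons, List.reverse_append, List.reverse_nil,
        if_pos hp', if_pos hq', if_neg hxy] at c1 c2 c3 c4 c5 ⊢
      split_ifs at c1 <;> omega

open Classical in
/-- **Dirac's theorem**. -/
theorem isHamiltonian_of_card_le_two_mul_degree [Fintype V] (hV : 3 ≤ Fintype.card V)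
    (hdeg : ∀ v, Fintype.card V ≤ 2 * G.degree v) : G.IsHamiltonian := by
  -- Take a cyclic enumeration with as many adjacent consecutive pairs as possible. A nonadjacent
  -- pair could be rotated to the two ends of the list and improved by `exists_countCyclic_lt`, so
  -- every pair is an edge.
  let S : Set ℕ := {k | ∃ l : List V, l.Nodup ∧ l.length = Fintype.card V ∧
    l.countCyclic G.Adj = k}
  have hne : S.Nonempty := ⟨_, Finset.univ.toList, Finset.nodup_toList _, by simp, rfl⟩
  have hbdd : BddAbove S := by
    refine ⟨Fintype.card V + 1, ?_⟩
    rintro k ⟨l, -, hl, rfl⟩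
    exact hl ▸ List.countCyclic_le _ l
  obtain ⟨l, hnd, hlen, hk⟩ := Nat.sSup_mem hne hbdd
  have hmax : ∀ l' : List V, l'.Nodup → l'.length = Fintype.card V →
      l'.countCyclic G.Adj ≤ l.countCyclic G.Adj := by
    intro l' h1 h2
    rw [hk]
    exact le_csSup hbdd ⟨l', h1, h2, rfl⟩
  cases l with
  | nil => simp at hlen; omega
  | cons a t =>
    refine isHamiltonian_of_isChain hV a t hnd hlen ?_
    rw [List.isChain_iff_forall_rel_of_append_cons_cons]
    intro x y X Y hXY
    by_contra hxy
    -- Either the bad pair is the closing one and the list already has the required ends, or it is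
    -- interior and the list is rotated to begin at `y`.
    rcases List.eq_nil_or_concat Y with rfl | ⟨Y, b, rfl⟩
    · have h' : (a :: t) ++ [a] = (X ++ [x]) ++ [y] := by simpa using hXY
      obtain ⟨h1, h2⟩ := List.append_inj' h' rfl
      simp only [List.cons.injEq, and_true] at h2
      subst h2
      cases X with
      | nil =>
        simp only [List.nil_append, List.cons.injEq] at h1
        simp [h1.2] at hlen
        omega
      | cons c X =>
        obtain ⟨rfl, rfl⟩ : a = c ∧ t = X ++ [x] := by simpa using h1
        obtain ⟨l', h3, h4, h5⟩ := exists_countCyclic_lt hdeg a x X hnd hlen hxy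
        exact absurd (hmax l' h3 h4) (not_le.mpr h5)
    · have h' : (a :: t) ++ [a] = (X ++ x :: y :: Y) ++ [b] := by simpa using hXY
      have h1 := (List.append_inj' h' rfl).1
      have hperm : (a :: t).Perm (y :: (Y ++ X) ++ [x]) := by
        rw [h1, List.append_cons]
        refine List.perm_append_comm.trans ?_
        simp
      have hcyc : (y :: (Y ++ X) ++ [x]).countCyclic G.Adj = (a :: t).countCyclic G.Adj := by
        rw [h1]
        cases X with
        | nil => simpa using List.countCyclic_rotate G.Adj x [] y Y
        | cons c X =>
          have := List.countCyclic_rotate G.Adj c (X ++ [x]) y Y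
          simpa using this
      obtain ⟨l', h3, h4, h5⟩ := exists_countCyclic_lt hdeg y x (Y ++ X)
        (hperm.nodup_iff.mp hnd) (hperm.length_eq.symm.trans hlen) hxy
      rw [hcyc] at h5
      exact absurd (hmax l' h3 h4) (not_le.mpr h5)

/-! ### Complements -/

theorem IsAsymmetric.compl (h : G.IsAsymmetric) : Gᶜ.IsAsymmetric := by
  intro σ v
  refine h ⟨σ.toEquiv, ?_⟩ v
  intro a b
  have := σ.map_adj_iff (v := a) (w := b)
  simp only [compl_adj] at this
  have hab : σ a = σ b ↔ a = b := σ.injective.eq_iff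
  by_cases hc : a = b
  · subst hc; simp
  · have h1 : ¬ σ a = σ b := fun h => hc (hab.mp h)
    simp only [ne_eq, h1, hc, not_false_eq_true, true_and] at this
    exact not_iff_not.mp this

theorem IsRegularAsymmetricHamiltonian.compl [Fintype V] {k : ℕ}
    (h : G.IsRegularAsymmetricHamiltonian k) (hV : 3 ≤ Fintype.card V)
    (hk : 2 * k + 2 ≤ Fintype.card V) :
    Gᶜ.IsRegularAsymmetricHamiltonian (Fintype.card V - 1 - k) := by
  classical
  have hreg : Gᶜ.IsRegularOfDegree (Fintype.card V - 1 - k) := by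
    convert IsRegularOfDegree.compl (G := G) (k := k) _
    convert h.regular
  refine ⟨by convert hreg, h.asymmetric.compl, ?_⟩
  have := isHamiltonian_of_card_le_two_mul_degree (G := Gᶜ) hV (fun v => by
    have e : Gᶜ.degree v = Fintype.card V - 1 - k := hreg v
    have e' : Fintype.card V ≤ 2 * Gᶜ.degree v := by rw [e]; omega
    convert e')
  convert this

/-! ### Asymmetry by colour refinement -/

/-- Iterated colour refinement with respect to given neighbourhoods, starting from the number of
closed walks of length three. -/
def refinedColour [DecidableEq V] (N : V → Finset V) : ℕ → V → ℕ
  | 0, v => ∑ w ∈ N v, (N w ∩ N v).card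
  | k + 1, v => refinedColour N k v + ∑ w ∈ N v, refinedColour N k w ^ 2

/-- Every refined colour is defined from neighbourhoods alone, so automorphisms preserve it. Passing
`N` explicitly lets the hypothesis `hk` be decided by evaluation on a concrete graph. -/
theorem IsAsymmetric.of_refinedColour_injective [DecidableEq V] (N : V → Finset V)
    (hN : ∀ v w, G.Adj v w ↔ w ∈ N v) (k : ℕ) (hk : Function.Injective (refinedColour N k)) :
    G.IsAsymmetric := by
  intro σ
  have hmap : ∀ v, N (σ v) = (N v).map σ.toEquiv.toEmbedding := by
    intro v
    ext w
    obtain ⟨u, rfl⟩ := σ.surjective w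
    rw [← hN, σ.map_adj_iff, hN]
    simp only [Finset.mem_map, Equiv.coe_toEmbedding]
    constructor
    · intro h; exact ⟨u, h, rfl⟩
    · rintro ⟨u', h, h'⟩; exact σ.injective h' ▸ h
  have hinv : ∀ k v, refinedColour N k (σ v) = refinedColour N k v := by
    intro k
    induction k with
    | zero =>
      intro v
      simp only [refinedColour]
      rw [hmap, Finset.sum_map]
      refine Finset.sum_congr rfl fun w _ => ?_
      have : N (σ.toEquiv.toEmbedding w) = (N w).map σ.toEquiv.toEmbedding := hmap w
      rw [this, ← Finset.map_inter, Finset.card_map]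
    | succ k ih =>
      intro v
      simp only [refinedColour]
      rw [ih, hmap, Finset.sum_map]
      congr 1
      refine Finset.sum_congr rfl fun w _ => ?_
      have : refinedColour N k (σ.toEquiv.toEmbedding w) = refinedColour N k w := ih w
      rw [this]
  intro v
  exact hk (hinv k v)

end SimpleGraph

/-! ### The adjacency relations in linear form -/

/-- Adjacency in the cubic graph on `2 * m` vertices. -/
def cubicAdj (m x y : ℕ) : Prop :=
  y = x + 1 ∨ x = y + 1 ∨ (x = 0 ∧ y + 1 = 2 * m) ∨ (y = 0 ∧ x + 1 = 2 * m) ∨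
  (x = 0 ∧ y + 1 = m) ∨ (y = 0 ∧ x + 1 = m) ∨
  (x = 1 ∧ y + 2 = 2 * m) ∨ (y = 1 ∧ x + 2 = 2 * m) ∨
  (x + 1 = 2 * m ∧ y + 3 = 2 * m) ∨ (y + 1 = 2 * m ∧ x + 3 = 2 * m) ∨
  (2 ≤ x ∧ 2 ≤ y ∧ x + y + 2 = 2 * m ∧ x ≠ y)

/-- The edges added to the cubic graph on `4 * h` vertices. -/
def evenExtraAdj (h x y : ℕ) : Prop :=
  (x = h ∧ y = 3 * h) ∨ (y = h ∧ x = 3 * h) ∨ (x ≠ y ∧ (x + y = 2 * h ∨ x + y = 6 * h))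

/-- The edges added to the cubic graph on `2 * m` vertices when `m` is odd. -/
def oddExtraAdj (m x y : ℕ) : Prop :=
  (x = 1 ∧ y = m + 1) ∨ (y = 1 ∧ x = m + 1) ∨ (x ≠ y ∧ (x + y = 2 ∨ x + y = 2 * m + 2))

/-- Replaces a remainder modulo a variable, which `omega` treats as opaque, by a linear case split.
-/
theorem Nat.mod_of_lt_two_mul {a n : ℕ} (h : a < 2 * n) :
    a < n ∧ a % n = a ∨ n ≤ a ∧ a % n = a - n := by
  rcases lt_or_ge a n with h1 | h1
  · exact Or.inl ⟨h1, Nat.mod_eq_of_lt h1⟩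
  · exact Or.inr ⟨h1, by rw [Nat.mod_eq_sub_mod h1, Nat.mod_eq_of_lt (by omega)]⟩

theorem cubicRel_or_iff {m : ℕ} (hm : 6 ≤ m) (x y : Fin (2 * m)) :
    (cubicRel (2 * m) x y ∨ cubicRel (2 * m) y x) ↔ cubicAdj m x y := by
  have hx := x.isLt
  have hy := y.isLt
  have h1 := Nat.mod_of_lt_two_mul (a := x.val + 1) (n := 2 * m) (by omega)
  have h2 := Nat.mod_of_lt_two_mul (a := y.val + 1) (n := 2 * m) (by omega)
  unfold cubicRel cubicAdj
  generalize (x.val + 1) % (2 * m) = a at *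
  generalize (y.val + 1) % (2 * m) = b at *
  generalize x.val = x at *
  generalize y.val = y at *
  constructor
  · have aux : ∀ x y a : ℕ, x < 2 * m → y < 2 * m →
        (x + 1 < 2 * m ∧ a = x + 1 ∨ 2 * m ≤ x + 1 ∧ a = x + 1 - 2 * m) → y = a →
        y = x + 1 ∨ (y = 0 ∧ x + 1 = 2 * m) := by omega
    rintro ((h | h | h | h | ⟨k, h⟩) | (h | h | h | h | ⟨k, h⟩))
    · rcases aux x y a hx hy h1 h with h | h
      · exact Or.inl h
      · exact Or.inr (Or.inr (Or.inr (Or.inl h)))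
    · exact Or.inr (Or.inr (Or.inr (Or.inr (Or.inl (by omega)))))
    · exact Or.inr (Or.inr (Or.inr (Or.inr (Or.inr (Or.inr (Or.inl (by omega)))))))
    · iterate 8 right
      left; omega
    · iterate 10 right
      omega
    · rcases aux y x b hy hx h2 h with h | h
      · exact Or.inr (Or.inl h)
      · exact Or.inr (Or.inr (Or.inl h))
    · exact Or.inr (Or.inr (Or.inr (Or.inr (Or.inr (Or.inl (by omega))))))
    · exact Or.inr (Or.inr (Or.inr (Or.inr (Or.inr (Or.inr (Or.inr (Or.inl (by omega))))))))
    · iterate 9 right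
      left; omega
    · iterate 10 right
      omega
  · rintro (h | h | h | h | h | h | h | h | h | h | h)
    · left; left; omega
    · right; left; omega
    · right; left; omega
    · left; left; omega
    · left; right; left; omega
    · right; right; left; omega
    · left; right; right; left; omega
    · right; right; right; left; omega
    · left; right; right; right; left; omega
    · right; right; right; right; left; omega
    · rcases lt_or_gt_of_ne h.2.2.2 with h' | h'
      · left; right; right; right; right; exact ⟨x, by omega⟩
      · right; right; right; right; right; exact ⟨y, by omega⟩

theorem cubicAdj_ne {m x y : ℕ} (hm : 6 ≤ m) (h : cubicAdj m x y) : x ≠ y := by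
  unfold cubicAdj at h; omega

theorem cubicGraph_adj {m : ℕ} (hm : 6 ≤ m) (x y : Fin (2 * m)) :
    (cubicGraph (2 * m)).Adj x y ↔ cubicAdj m x y := by
  rw [cubicGraph, SimpleGraph.fromRel_adj, cubicRel_or_iff hm]
  exact ⟨fun h => h.2, fun h => ⟨fun e => cubicAdj_ne hm h (congrArg _ e), h⟩⟩

theorem evenExtraRel_or_iff {h : ℕ} (hh : 3 ≤ h) (x y : Fin (4 * h)) :
    (quarticExtraRel (4 * h) x y ∨ quarticExtraRel (4 * h) y x) ↔ evenExtraAdj h x y := by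
  have hx := x.isLt
  have hy := y.isLt
  have e1 : 4 * h % 4 = 0 := by omega
  have e2 : 4 * h / 4 = h := by omega
  have e3 : 3 * (4 * h) / 4 = 3 * h := by omega
  have e4 : 4 * h / 2 = 2 * h := by omega
  have mods : ∀ i, 1 ≤ i → i ≤ 2 * h - 1 → (h + i) % (4 * h) = h + i ∧
      (i ≤ h ∧ (4 * h + h - i) % (4 * h) = h - i ∨
        h < i ∧ (4 * h + h - i) % (4 * h) = 5 * h - i) := by
    intro i h1 h2
    refine ⟨Nat.mod_eq_of_lt (by omega), ?_⟩
    have := Nat.mod_of_lt_two_mul (a := 4 * h + h - i) (n := 4 * h) (by omega)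
    omega
  unfold quarticExtraRel evenExtraAdj
  simp only [e1, e2, e3, e4, true_and, show ¬ (0 = 2) by decide, false_and, or_false]
  generalize x.val = x at *
  generalize y.val = y at *
  constructor
  · rintro ((h | ⟨i, h1, h2, h3, h4⟩) | (h | ⟨i, h1, h2, h3, h4⟩))
    · omega
    · have := mods i h1 h2; omega
    · omega
    · have := mods i h1 h2; omega
  · have aux : ∀ x y : ℕ, x < 4 * h → y < 4 * h → x ≠ y → (x + y = 2 * h ∨ x + y = 6 * h) →
        h < x → x < 3 * h →
        ∃ i, 1 ≤ i ∧ i ≤ 2 * h - 1 ∧ x = (h + i) % (4 * h) ∧ y = (4 * h + h - i) % (4 * h) := by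
      intro x y _ _ _ _ _ _
      have := mods (x - h) (by omega) (by omega)
      exact ⟨x - h, by omega⟩
    rintro (h1 | h1 | ⟨h1, h2⟩)
    · exact Or.inl (Or.inl h1)
    · exact Or.inr (Or.inl ⟨h1.1, h1.2⟩)
    · by_cases h3 : h < x ∧ x < 3 * h
      · exact Or.inl (Or.inr (aux x y hx hy h1 h2 h3.1 h3.2))
      · exact Or.inr (Or.inr (aux y x hy hx h1.symm (by omega) (by omega) (by omega)))

theorem oddExtraRel_or_iff {m : ℕ} (hm : 6 ≤ m) (hodd : m % 2 = 1) (x y : Fin (2 * m)) :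
    (quarticExtraRel (2 * m) x y ∨ quarticExtraRel (2 * m) y x) ↔ oddExtraAdj m x y := by
  have hx := x.isLt
  have hy := y.isLt
  have e1 : 2 * m % 4 = 2 := by omega
  have e4 : 2 * m / 2 = m := by omega
  have mods : ∀ i, 1 ≤ i → i ≤ m - 1 → (1 + i) % (2 * m) = 1 + i ∧
      (i ≤ 1 ∧ (2 * m + 1 - i) % (2 * m) = 1 - i ∨
        1 < i ∧ (2 * m + 1 - i) % (2 * m) = 2 * m + 1 - i) := by
    intro i h1 h2
    refine ⟨Nat.mod_eq_of_lt (by omega), ?_⟩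
    have := Nat.mod_of_lt_two_mul (a := 2 * m + 1 - i) (n := 2 * m) (by omega)
    omega
  unfold quarticExtraRel oddExtraAdj
  simp only [e1, e4, true_and, show ¬ (2 = 0) by decide, false_and, false_or]
  generalize x.val = x at *
  generalize y.val = y at *
  constructor
  · rintro ((h | ⟨i, h1, h2, h3, h4⟩) | (h | ⟨i, h1, h2, h3, h4⟩))
    · omega
    · have := mods i h1 h2; omega
    · omega
    · have := mods i h1 h2; omega
  · have aux : ∀ x y : ℕ, x < 2 * m → y < 2 * m → x ≠ y → (x + y = 2 ∨ x + y = 2 * m + 2) →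
        1 < x → x < m + 1 →
        ∃ i, 1 ≤ i ∧ i ≤ m - 1 ∧ x = (1 + i) % (2 * m) ∧ y = (2 * m + 1 - i) % (2 * m) := by
      intro x y _ _ _ _ _ _
      have := mods (x - 1) (by omega) (by omega)
      exact ⟨x - 1, by omega⟩
    rintro (h1 | h1 | ⟨h1, h2⟩)
    · exact Or.inl (Or.inl h1)
    · exact Or.inr (Or.inl ⟨h1.1, h1.2⟩)
    · by_cases h3 : 1 < x ∧ x < m + 1
      · exact Or.inl (Or.inr (aux x y hx hy h1 h2 h3.1 h3.2))
      · exact Or.inr (Or.inr (aux y x hy hx h1.symm (by omega) (by omega) (by omega)))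

/-- Adjacency in the quartic graph on `4 * h` vertices. -/
def evenQuarticAdj (h x y : ℕ) : Prop := cubicAdj (2 * h) x y ∨ evenExtraAdj h x y

/-- Adjacency in the quartic graph on `2 * m` vertices when `m` is odd. -/
def oddQuarticAdj (m x y : ℕ) : Prop := cubicAdj m x y ∨ oddExtraAdj m x y

theorem quarticGraph_adj_iff {n : ℕ} (x y : Fin n) :
    (quarticGraph n).Adj x y ↔ x ≠ y ∧ ((cubicRel n x y ∨ cubicRel n y x) ∨
      (quarticExtraRel n x y ∨ quarticExtraRel n y x)) := by
  rw [quarticGraph, SimpleGraph.fromRel_adj]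
  tauto

theorem quarticGraph_adj_of_odd {m : ℕ} (hm : 6 ≤ m) (hodd : m % 2 = 1) (x y : Fin (2 * m)) :
    (quarticGraph (2 * m)).Adj x y ↔ oddQuarticAdj m x y := by
  rw [quarticGraph_adj_iff, cubicRel_or_iff hm, oddExtraRel_or_iff hm hodd]
  refine ⟨fun h => h.2, fun h => ⟨fun e => ?_, h⟩⟩
  subst e
  rcases h with h | h
  · exact cubicAdj_ne hm h rfl
  · unfold oddExtraAdj at h; omega

theorem quarticGraph_adj_of_even {h : ℕ} (hh : 3 ≤ h) (x y : Fin (4 * h)) :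
    (quarticGraph (4 * h)).Adj x y ↔ evenQuarticAdj h x y := by
  have hc : (cubicRel (4 * h) x y ∨ cubicRel (4 * h) y x) ↔ cubicAdj (2 * h) x y := by
    have e : 4 * h = 2 * (2 * h) := by ring
    have := cubicRel_or_iff (m := 2 * h) (by omega) (Fin.cast e x) (Fin.cast e y)
    unfold cubicRel at this ⊢
    simpa only [Fin.val_cast, ← e] using this
  rw [quarticGraph_adj_iff, hc, evenExtraRel_or_iff hh]
  refine ⟨fun h => h.2, fun h' => ⟨fun e => ?_, h'⟩⟩
  subst e
  rcases h' with h' | h'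
  · exact cubicAdj_ne (by omega) h' rfl
  · unfold evenExtraAdj at h'; omega

/-! ### Regularity and Hamiltonicity -/

/-- Every vertex has three neighbours in the cubic graph. -/
theorem exists_cubicAdj_iff {m x : ℕ} (hm : 6 ≤ m) (hx : x < 2 * m) :
    ∃ a b c, a < 2 * m ∧ b < 2 * m ∧ c < 2 * m ∧ a ≠ b ∧ a ≠ c ∧ b ≠ c ∧
      ∀ y < 2 * m, cubicAdj m x y ↔ y = a ∨ y = b ∨ y = c := by
  unfold cubicAdj
  rcases (by omega : x = 0 ∨ x = 1 ∨ x + 1 = m ∨ x + 1 = 2 * m ∨ x + 2 = 2 * m ∨ x + 3 = 2 * m ∨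
    (2 ≤ x ∧ x + 4 ≤ 2 * m ∧ x + 1 ≠ m)) with rfl | rfl | h | h | h | h | h
  · exact ⟨1, 2 * m - 1, m - 1, by omega, by omega, by omega, by omega, by omega, by omega,
      fun y hy => by omega⟩
  · exact ⟨0, 2, 2 * m - 2, by omega, by omega, by omega, by omega, by omega, by omega,
      fun y hy => by omega⟩
  · exact ⟨m - 2, m, 0, by omega, by omega, by omega, by omega, by omega, by omega,
      fun y hy => by omega⟩
  · exact ⟨0, 2 * m - 2, 2 * m - 3, by omega, by omega, by omega, by omega, by omega, by omega,
      fun y hy => by omega⟩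
  · exact ⟨1, 2 * m - 1, 2 * m - 3, by omega, by omega, by omega, by omega, by omega, by omega,
      fun y hy => by omega⟩
  · exact ⟨2 * m - 1, 2 * m - 2, 2 * m - 4, by omega, by omega, by omega, by omega, by omega,
      by omega, fun y hy => by omega⟩
  · exact ⟨x - 1, x + 1, 2 * m - 2 - x, by omega, by omega, by omega, by omega, by omega,
      by omega, fun y hy => by omega⟩

/-- The added edges match `x` with its mirror image `2h - x` modulo `4h`, the two mirror-fixed
vertices `h` and `3h` being matched together. Avoiding the cubic edges is what raises the degree
from three to four. -/
theorem exists_evenExtraAdj_iff {h x : ℕ} (hh : 3 ≤ h) (hx : x < 4 * h) :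
    ∃ d < 4 * h, ¬ cubicAdj (2 * h) x d ∧ ∀ y < 4 * h, evenExtraAdj h x y ↔ y = d := by
  unfold evenExtraAdj cubicAdj
  rcases (by omega : x = h ∨ x = 3 * h ∨ (x ≠ h ∧ x ≤ 2 * h) ∨ (2 * h < x ∧ x ≠ 3 * h)) with
    rfl | rfl | h1 | h1
  · exact ⟨3 * x, by omega, by omega, fun y hy => by omega⟩
  · exact ⟨h, by omega, by omega, fun y hy => by omega⟩
  · exact ⟨2 * h - x, by omega, by omega, fun y hy => by omega⟩
  · exact ⟨6 * h - x, by omega, by omega, fun y hy => by omega⟩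

/-- The same with the reflection `x ↦ 2 - x` modulo `2m`, whose fixed points are `1` and `m + 1`. -/
theorem exists_oddExtraAdj_iff {m x : ℕ} (hm : 6 ≤ m) (hodd : m % 2 = 1) (hx : x < 2 * m) :
    ∃ d < 2 * m, ¬ cubicAdj m x d ∧ ∀ y < 2 * m, oddExtraAdj m x y ↔ y = d := by
  unfold oddExtraAdj cubicAdj
  rcases (by omega : x = 1 ∨ x = m + 1 ∨ x = 0 ∨ x = 2 ∨ (2 < x ∧ x ≠ m + 1)) with
    rfl | rfl | rfl | rfl | h
  · exact ⟨m + 1, by omega, by omega, fun y hy => by omega⟩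
  · exact ⟨1, by omega, by omega, fun y hy => by omega⟩
  · exact ⟨2, by omega, by omega, fun y hy => by omega⟩
  · exact ⟨0, by omega, by omega, fun y hy => by omega⟩
  · exact ⟨2 * m + 2 - x, by omega, by omega, fun y hy => by omega⟩

open Classical in
theorem SimpleGraph.degree_eq_of_adj_iff {V : Type*} [Fintype V] {G : SimpleGraph V} {v : V}
    (s : Finset V) (hs : ∀ w, G.Adj v w ↔ w ∈ s) : G.degree v = s.card := by
  rw [← card_neighborFinset_eq_degree]
  congr 1
  ext w
  rw [mem_neighborFinset, hs]

open Classical in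
theorem cubicGraph_isRegularOfDegree {m : ℕ} (hm : 6 ≤ m) :
    (cubicGraph (2 * m)).IsRegularOfDegree 3 := by
  intro x
  obtain ⟨a, b, c, ha, hb, hc, hab, hac, hbc, h⟩ := exists_cubicAdj_iff hm x.isLt
  rw [SimpleGraph.degree_eq_of_adj_iff {⟨a, ha⟩, ⟨b, hb⟩, ⟨c, hc⟩}]
  · rw [Finset.card_eq_three]
    exact ⟨_, _, _, by simpa using hab, by simpa using hac, by simpa using hbc, rfl⟩
  · intro y
    rw [cubicGraph_adj hm, h y y.isLt]
    simp [Fin.ext_iff]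

open Classical in
theorem quarticGraph_isRegularOfDegree {n m : ℕ} (hn : n = 2 * m) (hm : 6 ≤ m)
    {R : ℕ → ℕ → Prop}
    (hadj : ∀ x y : Fin n, (quarticGraph n).Adj x y ↔ cubicAdj m x y ∨ R x y)
    (hR : ∀ x < n, ∃ d < n, ¬ cubicAdj m x d ∧ ∀ y < n, R x y ↔ y = d) :
    (quarticGraph n).IsRegularOfDegree 4 := by
  subst hn
  intro x
  obtain ⟨a, b, c, ha, hb, hc, hab, hac, hbc, h⟩ := exists_cubicAdj_iff hm x.isLt
  obtain ⟨d, hd, hd', h'⟩ := hR x x.isLt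
  rw [h d hd] at hd'
  push Not at hd'
  rw [SimpleGraph.degree_eq_of_adj_iff {⟨d, hd⟩, ⟨a, ha⟩, ⟨b, hb⟩, ⟨c, hc⟩}]
  · rw [Finset.card_insert_of_notMem (by simpa using hd'), Finset.card_eq_three.mpr]
    exact ⟨_, _, _, by simpa using hab, by simpa using hac, by simpa using hbc, rfl⟩
  · intro y
    rw [hadj, h y y.isLt, h' y y.isLt]
    simp only [Finset.mem_insert, Finset.mem_singleton, Fin.ext_iff]
    tauto

theorem cubicGraph_isHamiltonian {n : ℕ} (hn : 3 ≤ n) : (cubicGraph n).IsHamiltonian := by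
  refine SimpleGraph.isHamiltonian_of_cyclic_enumeration hn (Fintype.card_fin n) id
    Function.injective_id fun i j hij => ?_
  rw [cubicGraph, SimpleGraph.fromRel_adj]
  refine ⟨?_, Or.inl (Or.inl hij)⟩
  rintro rfl
  have := i.isLt
  have := Nat.mod_of_lt_two_mul (a := i.val + 1) (n := n) (by omega)
  simp only [id] at hij
  omega

theorem cubicGraph_le_quarticGraph (n : ℕ) : cubicGraph n ≤ quarticGraph n := by
  intro x y h
  rw [cubicGraph, SimpleGraph.fromRel_adj] at h
  rw [quarticGraph_adj_iff]
  exact ⟨h.1, Or.inl h.2⟩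

theorem quarticGraph_isHamiltonian {n : ℕ} (hn : 3 ≤ n) : (quarticGraph n).IsHamiltonian :=
  (cubicGraph_isHamiltonian hn).mono (cubicGraph_le_quarticGraph n)

/-! ### The small cases -/

instance (m x y : ℕ) : Decidable (cubicAdj m x y) := by unfold cubicAdj; infer_instance
instance (h x y : ℕ) : Decidable (evenQuarticAdj h x y) := by
  unfold evenQuarticAdj evenExtraAdj; infer_instance
instance (m x y : ℕ) : Decidable (oddQuarticAdj m x y) := by
  unfold oddQuarticAdj oddExtraAdj; infer_instance

/-- Here `h = 3`, and the vertex `3h` coincides with the exceptional vertex `4h - 3`, so the general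
neighbourhood formulas break down. -/
theorem quarticGraph_twelve_isAsymmetric : (quarticGraph 12).IsAsymmetric := by
  refine SimpleGraph.IsAsymmetric.of_refinedColour_injective
    (fun v => Finset.univ.filter fun w : Fin 12 => evenQuarticAdj 3 v w) ?_ 2 ?_
  · intro v w
    rw [quarticGraph_adj_of_even (h := 3) le_rfl]
    simp
  · decide +kernel

/-- Here `m = 7`, and the edge from `2m - 3` to `5 = m - 2` is an extra link between the end
triangle and the bowtie, absent for larger odd `m`. -/
theorem quarticGraph_fourteen_isAsymmetric : (quarticGraph 14).IsAsymmetric := by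
  refine SimpleGraph.IsAsymmetric.of_refinedColour_injective
    (fun v => Finset.univ.filter fun w : Fin 14 => oddQuarticAdj 7 v w) ?_ 3 ?_
  · intro v w
    rw [quarticGraph_adj_of_odd (m := 7) (by decide) (by decide)]
    simp
  · decide +kernel

/-! ### Automorphisms as maps of natural numbers -/

/-- The map `s` permutes `{0, …, n - 1}` and preserves the relation `R` on it. -/
structure IsRelAut (n : ℕ) (R : ℕ → ℕ → Prop) (s : ℕ → ℕ) : Prop where
  lt : ∀ x < n, s x < n
  inj : ∀ x < n, ∀ y < n, s x = s y → x = y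
  surj : ∀ y < n, ∃ x < n, s x = y
  rel : ∀ x < n, ∀ y < n, (R (s x) (s y) ↔ R x y)

/-- Moves automorphisms from `Fin n` to functions on `ℕ`, where adjacency is linear arithmetic
within reach of `omega`. -/
theorem SimpleGraph.isAsymmetric_of_isRelAut {n : ℕ} {G : SimpleGraph (Fin n)} {R : ℕ → ℕ → Prop}
    (hR : ∀ x y : Fin n, G.Adj x y ↔ R x y)
    (h : ∀ s, IsRelAut n R s → ∀ x < n, s x = x) : G.IsAsymmetric := by
  intro σ v
  let s : ℕ → ℕ := fun x => if hx : x < n then (σ ⟨x, hx⟩).val else x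
  have hs : ∀ x : Fin n, s x = (σ x).val := fun x => dif_pos x.isLt
  have hs' : ∀ x (hx : x < n), s x = (σ ⟨x, hx⟩).val := fun x hx => dif_pos hx
  have haut : IsRelAut n R s := by
    refine ⟨?_, ?_, ?_, ?_⟩
    · intro x hx
      rw [hs' x hx]; exact Fin.isLt _
    · intro x hx y hy hxy
      rw [hs' x hx, hs' y hy] at hxy
      exact congrArg Fin.val (σ.injective (Fin.ext hxy))
    · intro y hy
      obtain ⟨x, hx⟩ := σ.surjective ⟨y, hy⟩
      exact ⟨x, x.isLt, by rw [hs, hx]⟩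
    · intro x hx y hy
      rw [hs' x hx, hs' y hy, ← hR, σ.map_adj_iff, hR]
  exact Fin.ext ((hs v).symm.trans (h s haut v v.isLt))

namespace IsRelAut

variable {n : ℕ} {R : ℕ → ℕ → Prop} {s : ℕ → ℕ}

theorem map_rel (H : IsRelAut n R s) {x y : ℕ} (hx : x < n) (hy : y < n) (h : R x y) :
    R (s x) (s y) := (H.rel x hx y hy).mpr h

/-- The only common neighbour of two fixed vertices that is not known to be fixed is fixed. -/
theorem fixed_of_common (H : IsRelAut n R s) {u v w : ℕ} (hu : u < n) (hv : v < n) (hw : w < n)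
    (fu : s u = u) (fv : s v = v) (huw : R u w) (hvw : R v w)
    (h : ∀ y < n, R u y → R v y → y = w ∨ s y = y) : s w = w := by
  have h1 := H.map_rel hu hw huw
  have h2 := H.map_rel hv hw hvw
  rw [fu] at h1
  rw [fv] at h2
  -- If the image `s w` is itself fixed, then `s (s w) = s w`, and injectivity gives `s w = w`.
  rcases h _ (H.lt w hw) h1 h2 with h3 | h3
  · exact h3
  · exact H.inj _ (H.lt w hw) _ hw h3

/-- The only neighbour of a fixed vertex that is not known to be fixed is fixed. -/
theorem fixed_of_adj (H : IsRelAut n R s) {v w : ℕ} (hv : v < n) (hw : w < n)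
    (fv : s v = v) (hvw : R v w) (h : ∀ y < n, R v y → y = w ∨ s y = y) : s w = w :=
  H.fixed_of_common hv hv hw fv fv hvw hvw fun y hy h1 _ => h y hy h1

end IsRelAut

/-- The vertex `v` lies on a triangle of the relation `R` on `{0, …, n - 1}`. -/
def OnTriangle (n : ℕ) (R : ℕ → ℕ → Prop) (v : ℕ) : Prop :=
  ∃ a < n, ∃ b < n, R v a ∧ R v b ∧ R a b

theorem IsRelAut.onTriangle_iff {n : ℕ} {R : ℕ → ℕ → Prop} {s : ℕ → ℕ} (H : IsRelAut n R s)
    {v : ℕ} (hv : v < n) : OnTriangle n R (s v) ↔ OnTriangle n R v := by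
  constructor
  · rintro ⟨a, ha, b, hb, h1, h2, h3⟩
    obtain ⟨a, ha', rfl⟩ := H.surj a ha
    obtain ⟨b, hb', rfl⟩ := H.surj b hb
    rw [H.rel _ hv _ ha'] at h1
    rw [H.rel _ hv _ hb'] at h2
    rw [H.rel _ ha' _ hb'] at h3
    exact ⟨a, ha', b, hb', h1, h2, h3⟩
  · rintro ⟨a, ha, b, hb, h1, h2, h3⟩
    exact ⟨_, H.lt a ha, _, H.lt b hb, H.map_rel hv ha h1, H.map_rel hv hb h2, H.map_rel ha hb h3⟩

/-! ### Neighbourhoods in the cubic graph -/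

section cubicNeighbours

variable {m x y : ℕ}

theorem cubicAdj_zero (hm : 6 ≤ m) (hy : y < 2 * m) :
    cubicAdj m 0 y ↔ y = 1 ∨ y + 1 = 2 * m ∨ y + 1 = m := by unfold cubicAdj; omega

theorem cubicAdj_one (hm : 6 ≤ m) (hy : y < 2 * m) :
    cubicAdj m 1 y ↔ y = 0 ∨ y = 2 ∨ y + 2 = 2 * m := by unfold cubicAdj; omega

theorem cubicAdj_middle (hm : 6 ≤ m) (hx : x + 1 = m) :
    cubicAdj m x y ↔ y = 0 ∨ y + 2 = m ∨ y = m := by unfold cubicAdj; omega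

theorem cubicAdj_sub_one (hm : 6 ≤ m) (hy : y < 2 * m) (hx : x + 1 = 2 * m) :
    cubicAdj m x y ↔ y = 0 ∨ y + 2 = 2 * m ∨ y + 3 = 2 * m := by unfold cubicAdj; omega

theorem cubicAdj_sub_two (hm : 6 ≤ m) (hy : y < 2 * m) (hx : x + 2 = 2 * m) :
    cubicAdj m x y ↔ y = 1 ∨ y + 1 = 2 * m ∨ y + 3 = 2 * m := by unfold cubicAdj; omega

theorem cubicAdj_sub_three (hm : 6 ≤ m) (hy : y < 2 * m) (hx : x + 3 = 2 * m) :
    cubicAdj m x y ↔ y + 1 = 2 * m ∨ y + 2 = 2 * m ∨ y + 4 = 2 * m := by unfold cubicAdj; omega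

theorem cubicAdj_generic (hm : 6 ≤ m) (h2 : 2 ≤ x) (h4 : x + 4 ≤ 2 * m)
    (hx : x + 1 ≠ m) :
    cubicAdj m x y ↔ y + 1 = x ∨ y = x + 1 ∨ x + y + 2 = 2 * m := by unfold cubicAdj; omega

end cubicNeighbours

/-! ### The cubic graph is asymmetric -/

/-- There are just two triangles: `m - 2, m - 1, m`, closed by the last rung, and `2m - 3, 2m - 2,
2m - 1`, closed by the short chord. -/
theorem cubicAdj_onTriangle_iff {m v : ℕ} (hm : 6 ≤ m) (hv : v < 2 * m) :
    OnTriangle (2 * m) (cubicAdj m) v ↔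
      v + 2 = m ∨ v + 1 = m ∨ v = m ∨ v + 3 = 2 * m ∨ v + 2 = 2 * m ∨ v + 1 = 2 * m := by
  constructor
  · rintro ⟨a, ha, b, hb, h1, h2, h3⟩
    by_contra hS
    rcases (by omega : v = 0 ∨ v = 1 ∨ (2 ≤ v ∧ v + 4 ≤ 2 * m ∧ v + 1 ≠ m)) with rfl | rfl | h
    · rw [cubicAdj_zero hm ha] at h1
      rw [cubicAdj_zero hm hb] at h2
      rcases h1 with h1 | h1 | h1
      · subst h1
        rw [cubicAdj_one hm hb] at h3; omega
      · rw [cubicAdj_sub_one hm hb h1] at h3; omega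
      · rw [cubicAdj_middle hm h1] at h3; omega
    · rw [cubicAdj_one hm ha] at h1
      rw [cubicAdj_one hm hb] at h2
      rcases h1 with h1 | h1 | h1
      · subst h1
        rw [cubicAdj_zero hm hb] at h3; omega
      · rw [cubicAdj_generic hm (by omega) (by omega) (by omega)] at h3; omega
      · rw [cubicAdj_sub_two hm hb h1] at h3; omega
    · rw [cubicAdj_generic hm h.1 h.2.1 h.2.2] at h1
      rw [cubicAdj_generic hm h.1 h.2.1 h.2.2] at h2
      unfold cubicAdj at h3
      omega
  · have mk : ∀ a b, a < 2 * m → b < 2 * m → cubicAdj m v a → cubicAdj m v b → cubicAdj m a b →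
        OnTriangle (2 * m) (cubicAdj m) v :=
      fun a b ha hb h1 h2 h3 => ⟨a, ha, b, hb, h1, h2, h3⟩
    rintro (h | h | h | h | h | h)
    · exact mk (m - 1) m (by omega) (by omega)
        ((cubicAdj_generic hm (by omega) (by omega) (by omega)).mpr (by omega))
        ((cubicAdj_generic hm (by omega) (by omega) (by omega)).mpr (by omega))
        ((cubicAdj_middle hm (by omega)).mpr (by omega))
    · exact mk m (m - 2) (by omega) (by omega)
        ((cubicAdj_middle hm (by omega)).mpr (by omega))
        ((cubicAdj_middle hm (by omega)).mpr (by omega))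
        ((cubicAdj_generic hm (by omega) (by omega) (by omega)).mpr (by omega))
    · exact mk (m - 1) (m - 2) (by omega) (by omega)
        ((cubicAdj_generic hm (by omega) (by omega) (by omega)).mpr (by omega))
        ((cubicAdj_generic hm (by omega) (by omega) (by omega)).mpr (by omega))
        ((cubicAdj_middle hm (by omega)).mpr (by omega))
    · exact mk (2 * m - 1) (2 * m - 2) (by omega) (by omega)
        ((cubicAdj_sub_three hm (by omega) (by omega)).mpr (by omega))
        ((cubicAdj_sub_three hm (by omega) (by omega)).mpr (by omega))
        ((cubicAdj_sub_one hm (by omega) (by omega)).mpr (by omega))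
    · exact mk (2 * m - 1) (2 * m - 3) (by omega) (by omega)
        ((cubicAdj_sub_two hm (by omega) (by omega)).mpr (by omega))
        ((cubicAdj_sub_two hm (by omega) (by omega)).mpr (by omega))
        ((cubicAdj_sub_one hm (by omega) (by omega)).mpr (by omega))
    · exact mk (2 * m - 2) (2 * m - 3) (by omega) (by omega)
        ((cubicAdj_sub_one hm (by omega) (by omega)).mpr (by omega))
        ((cubicAdj_sub_one hm (by omega) (by omega)).mpr (by omega))
        ((cubicAdj_sub_two hm (by omega) (by omega)).mpr (by omega))

theorem cubicAdj_fixed_zero {m : ℕ} (hm : 6 ≤ m) {s : ℕ → ℕ} (H : IsRelAut (2 * m) (cubicAdj m) s) :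
    s 0 = 0 := by
  have h0 := H.onTriangle_iff (v := 0) (by omega)
  have h1 := H.onTriangle_iff (v := m - 1) (by omega)
  have h2 := H.onTriangle_iff (v := 2 * m - 1) (by omega)
  rw [cubicAdj_onTriangle_iff hm (H.lt _ (by omega)),
    cubicAdj_onTriangle_iff hm (by omega)] at h0 h1 h2
  have a1 := H.map_rel (x := 0) (y := m - 1) (by omega) (by omega)
    ((cubicAdj_zero hm (by omega)).mpr (by omega))
  have a2 := H.map_rel (x := 0) (y := 2 * m - 1) (by omega) (by omega)
    ((cubicAdj_zero hm (by omega)).mpr (by omega))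
  have hne : s (m - 1) ≠ s (2 * m - 1) := fun e => by
    have := H.inj _ (by omega) _ (by omega) e
    omega
  have l0 := H.lt 0 (by omega)
  have l1 := H.lt (m - 1) (by omega)
  have l2 := H.lt (2 * m - 1) (by omega)
  replace h0 := mt h0.mp (by omega)
  replace h1 := h1.mpr (by omega)
  replace h2 := h2.mpr (by omega)
  generalize s 0 = y at *
  generalize s (m - 1) = a at *
  generalize s (2 * m - 1) = b at *
  rcases (by omega : y = 0 ∨ y = 1 ∨ (2 ≤ y ∧ y + 4 ≤ 2 * m ∧ y + 1 ≠ m)) with rfl | rfl | h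
  · rfl
  · rw [cubicAdj_one hm l1] at a1
    rw [cubicAdj_one hm l2] at a2
    omega
  · rw [cubicAdj_generic hm h.1 h.2.1 h.2.2] at a1
    rw [cubicAdj_generic hm h.1 h.2.1 h.2.2] at a2
    omega

theorem cubicAdj_fixed {m : ℕ} (hm : 6 ≤ m) {s : ℕ → ℕ} (H : IsRelAut (2 * m) (cubicAdj m) s) :
    ∀ x < 2 * m, s x = x := by
  have f0 := cubicAdj_fixed_zero hm H
  -- Of the three neighbours of `0`, only `1` lies on no triangle.
  have f1 : s 1 = 1 := by
    have a1 := H.map_rel (x := 0) (y := 1) (by omega) (by omega)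
      ((cubicAdj_zero hm (by omega)).mpr (by omega))
    rw [f0, cubicAdj_zero hm (H.lt _ (by omega))] at a1
    have h1 := H.onTriangle_iff (v := 1) (by omega)
    rw [cubicAdj_onTriangle_iff hm (H.lt _ (by omega)),
      cubicAdj_onTriangle_iff hm (by omega)] at h1
    omega
  have hinv : ∀ x < 2 * m, x ≠ 0 → s x ≠ 0 := fun x hx hx0 h =>
    hx0 (H.inj _ hx _ (by omega) (h.trans f0.symm))
  -- The path `0, 2m - 1, 2m - 2, 1` separates `2m - 1` from `m - 1`: apart from `0`, no neighbour
  -- of `m - 1` is adjacent to `1`.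
  obtain ⟨fn1, fn2⟩ : s (2 * m - 1) = 2 * m - 1 ∧ s (2 * m - 2) = 2 * m - 2 := by
    have a1 := H.map_rel (x := 0) (y := 2 * m - 1) (by omega) (by omega)
      ((cubicAdj_zero hm (by omega)).mpr (by omega))
    have a2 := H.map_rel (x := 1) (y := 2 * m - 2) (by omega) (by omega)
      ((cubicAdj_one hm (by omega)).mpr (by omega))
    have a3 := H.map_rel (x := 2 * m - 1) (y := 2 * m - 2) (by omega) (by omega)
      ((cubicAdj_sub_one hm (by omega) (by omega)).mpr (by omega))
    have l1 := H.lt (2 * m - 1) (by omega)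
    have l2 := H.lt (2 * m - 2) (by omega)
    have i2 := hinv (2 * m - 2) (by omega) (by omega)
    have i1 : s (2 * m - 1) ≠ 1 := fun h => by
      have := H.inj _ (by omega) _ (by omega) (h.trans f1.symm)
      omega
    rw [f0, cubicAdj_zero hm l1] at a1
    rw [f1, cubicAdj_one hm l2] at a2
    rcases a1 with h | h | h
    · omega
    · rw [cubicAdj_sub_one hm l2 h] at a3; omega
    · rw [cubicAdj_middle hm h] at a3; omega
  have f2 : s 2 = 2 := by
    refine H.fixed_of_adj (v := 1) (by omega) (by omega) f1
      ((cubicAdj_one hm (by omega)).mpr (by omega)) fun y hy h => ?_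
    rcases (cubicAdj_one hm hy).mp h with h | h | h
    · exact Or.inr (h ▸ f0)
    · exact Or.inl h
    · exact Or.inr ((by omega : y = 2 * m - 2) ▸ fn2)
  have fn3 : s (2 * m - 3) = 2 * m - 3 := by
    refine H.fixed_of_adj (v := 2 * m - 1) (by omega) (by omega) fn1
      ((cubicAdj_sub_one hm (by omega) (by omega)).mpr (by omega)) fun y hy h => ?_
    rcases (cubicAdj_sub_one hm hy (by omega)).mp h with h | h | h
    · exact Or.inr (h ▸ f0)
    · exact Or.inr ((by omega : y = 2 * m - 2) ▸ fn2)
    · exact Or.inl (by omega)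
  have fn4 : s (2 * m - 4) = 2 * m - 4 := by
    refine H.fixed_of_adj (v := 2 * m - 3) (by omega) (by omega) fn3
      ((cubicAdj_sub_three hm (by omega) (by omega)).mpr (by omega)) fun y hy h => ?_
    rcases (cubicAdj_sub_three hm hy (by omega)).mp h with h | h | h
    · exact Or.inr ((by omega : y = 2 * m - 1) ▸ fn1)
    · exact Or.inr ((by omega : y = 2 * m - 2) ▸ fn2)
    · exact Or.inl (by omega)
  -- The fixed set grows by one rung at a time: the outermost fixed vertices `k + 2` and `2m - 4 -
  -- k` are rung partners, and each has exactly one neighbour outside the set.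
  have main : ∀ k, k + 3 ≤ m → ∀ x < 2 * m, (x ≤ k + 2 ∨ 2 * m ≤ x + k + 4) → s x = x := by
    intro k
    induction k with
    | zero =>
      intro _ x hx h
      rcases (by omega : x = 0 ∨ x = 1 ∨ x = 2 ∨ x = 2 * m - 1 ∨ x = 2 * m - 2 ∨ x = 2 * m - 3 ∨
        x = 2 * m - 4) with rfl | rfl | rfl | rfl | rfl | rfl | rfl <;> assumption
    | succ k ih =>
      intro hk x hx h
      have ih := ih (by omega)
      by_cases h1 : x ≤ k + 2 ∨ 2 * m ≤ x + k + 4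
      · exact ih x hx h1
      · rcases (by omega : x = k + 3 ∨ x + k + 5 = 2 * m) with rfl | hx'
        · refine H.fixed_of_adj (v := k + 2) (by omega) (by omega) (ih _ (by omega) (by omega))
            ((cubicAdj_generic hm (by omega) (by omega) (by omega)).mpr (by omega))
            fun y hy h => ?_
          rw [cubicAdj_generic hm (by omega) (by omega) (by omega)] at h
          by_cases h3 : y = k + 3
          · exact Or.inl h3
          · exact Or.inr (ih y hy (by omega))
        · refine H.fixed_of_adj (v := x + 1) (by omega) (by omega) (ih _ (by omega) (by omega))
            ((cubicAdj_generic hm (by omega) (by omega) (by omega)).mpr (by omega))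
            fun y hy h => ?_
          rw [cubicAdj_generic hm (by omega) (by omega) (by omega)] at h
          by_cases h3 : y = x
          · exact Or.inl h3
          · exact Or.inr (ih y hy (by omega))
  intro x hx
  exact main (m - 3) (by omega) x hx (by omega)

theorem cubicGraph_isAsymmetric {m : ℕ} (hm : 6 ≤ m) : (cubicGraph (2 * m)).IsAsymmetric :=
  SimpleGraph.isAsymmetric_of_isRelAut (cubicGraph_adj hm) fun _ H => cubicAdj_fixed hm H

/-! ### Neighbourhoods in the quartic graph on `4 * h` vertices -/

section evenQuarticNeighbours

variable {h x y : ℕ}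

theorem evenExtraAdj_low (hy : y < 4 * h) (hx : x ≤ 2 * h) (hxh : x ≠ h) :
    evenExtraAdj h x y ↔ x + y = 2 * h := by unfold evenExtraAdj; omega

theorem evenExtraAdj_high (hx : 2 * h < x) (hx' : x < 4 * h) (hxh : x ≠ 3 * h) :
    evenExtraAdj h x y ↔ x + y = 6 * h := by unfold evenExtraAdj; omega

theorem evenQuarticAdj_zero (hh : 4 ≤ h) (hy : y < 4 * h) :
    evenQuarticAdj h 0 y ↔ y = 1 ∨ y + 1 = 4 * h ∨ y + 1 = 2 * h ∨ y = 2 * h := by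
  rw [evenQuarticAdj, cubicAdj_zero (by omega) (by omega),
    evenExtraAdj_low hy (by omega) (by omega)]
  omega

theorem evenQuarticAdj_one (hh : 4 ≤ h) (hy : y < 4 * h) :
    evenQuarticAdj h 1 y ↔ y = 0 ∨ y = 2 ∨ y + 2 = 4 * h ∨ y + 1 = 2 * h := by
  rw [evenQuarticAdj, cubicAdj_one (by omega) (by omega),
    evenExtraAdj_low hy (by omega) (by omega)]
  omega

theorem evenQuarticAdj_middle (hh : 4 ≤ h) (hy : y < 4 * h) (hx : x + 1 = 2 * h) :
    evenQuarticAdj h x y ↔ y = 0 ∨ y + 2 = 2 * h ∨ y = 2 * h ∨ y = 1 := by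
  rw [evenQuarticAdj, cubicAdj_middle (by omega) hx,
    evenExtraAdj_low hy (by omega) (by omega)]
  omega

theorem evenQuarticAdj_sub_one (hh : 4 ≤ h) (hy : y < 4 * h) (hx : x + 1 = 4 * h) :
    evenQuarticAdj h x y ↔ y = 0 ∨ y + 2 = 4 * h ∨ y + 3 = 4 * h ∨ y = 2 * h + 1 := by
  rw [evenQuarticAdj, cubicAdj_sub_one (by omega) (by omega) (by omega),
    evenExtraAdj_high (by omega) (by omega) (by omega)]
  omega

theorem evenQuarticAdj_sub_two (hh : 4 ≤ h) (hy : y < 4 * h) (hx : x + 2 = 4 * h) :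
    evenQuarticAdj h x y ↔ y = 1 ∨ y + 1 = 4 * h ∨ y + 3 = 4 * h ∨ y = 2 * h + 2 := by
  rw [evenQuarticAdj, cubicAdj_sub_two (by omega) (by omega) (by omega),
    evenExtraAdj_high (by omega) (by omega) (by omega)]
  omega

theorem evenQuarticAdj_quarter (hh : 4 ≤ h) (hy : y < 4 * h) :
    evenQuarticAdj h h y ↔ y + 1 = h ∨ y = h + 1 ∨ y + 2 = 3 * h ∨ y = 3 * h := by
  rw [evenQuarticAdj, cubicAdj_generic (by omega) (by omega) (by omega) (by omega)]
  unfold evenExtraAdj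
  omega

theorem evenQuarticAdj_three_quarters (hh : 4 ≤ h) (hy : y < 4 * h) :
    evenQuarticAdj h (3 * h) y ↔ y + 1 = 3 * h ∨ y = 3 * h + 1 ∨ y + 2 = h ∨ y = h := by
  rw [evenQuarticAdj, cubicAdj_generic (by omega) (by omega) (by omega) (by omega)]
  unfold evenExtraAdj
  omega

theorem evenQuarticAdj_low (hh : 4 ≤ h) (hy : y < 4 * h) (h2 : 2 ≤ x) (hx : x ≤ 2 * h)
    (hxh : x ≠ h) (hxm : x + 1 ≠ 2 * h) :
    evenQuarticAdj h x y ↔ y + 1 = x ∨ y = x + 1 ∨ x + y + 2 = 4 * h ∨ x + y = 2 * h := by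
  rw [evenQuarticAdj, cubicAdj_generic (by omega) (by omega) (by omega) (by omega),
    evenExtraAdj_low hy (by omega) (by omega)]
  omega

theorem evenQuarticAdj_high (hh : 4 ≤ h) (hy : y < 4 * h) (hx : 2 * h < x) (hx' : x + 4 ≤ 4 * h)
    (hxh : x ≠ 3 * h) :
    evenQuarticAdj h x y ↔ y + 1 = x ∨ y = x + 1 ∨ x + y + 2 = 4 * h ∨ x + y = 6 * h := by
  rw [evenQuarticAdj, cubicAdj_generic (by omega) (by omega) (by omega) (by omega),
    evenExtraAdj_high (by omega) (by omega) (by omega)]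
  omega

end evenQuarticNeighbours

/-! ### The quartic graph on `4 * h` vertices is asymmetric -/

theorem evenQuarticAdj_triangle {h v a b : ℕ} (hh : 4 ≤ h) (hv : v < 4 * h) (ha : a < 4 * h)
    (hb : b < 4 * h) (h1 : evenQuarticAdj h v a) (h2 : evenQuarticAdj h v b)
    (h3 : evenQuarticAdj h a b) (hva : v < a) (hab : a < b) :
    (v = 0 ∧ a = 1 ∧ b + 1 = 2 * h) ∨ (v = 0 ∧ a + 1 = 2 * h ∧ b = 2 * h) ∨
    (v + 1 = h ∧ a = h ∧ b = h + 1) ∨ (v + 2 = 2 * h ∧ a + 1 = 2 * h ∧ b = 2 * h) ∨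
    (v + 1 = 3 * h ∧ a = 3 * h ∧ b = 3 * h + 1) ∨
    (v + 3 = 4 * h ∧ a + 2 = 4 * h ∧ b + 1 = 4 * h) := by
  -- The edge `ab` stays a disjunction of linear conditions, examined only for those pairs of
  -- neighbours of `v` that the ordering `v < a < b` allows.
  unfold evenQuarticAdj cubicAdj evenExtraAdj at h3
  rcases (by omega : v = 0 ∨ v = 1 ∨ v + 1 = 2 * h ∨ v + 3 = 4 * h ∨ v = h ∨ v = 3 * h ∨
    (2 ≤ v ∧ v ≤ 2 * h ∧ v ≠ h ∧ v + 1 ≠ 2 * h) ∨ (2 * h < v ∧ v + 4 ≤ 4 * h ∧ v ≠ 3 * h)) with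
    rfl | rfl | h4 | h4 | rfl | rfl | h4 | h4
  · rw [evenQuarticAdj_zero hh ha] at h1
    rw [evenQuarticAdj_zero hh hb] at h2
    rcases h1 with h1 | h1 | h1 | h1 <;> rcases h2 with h2 | h2 | h2 | h2 <;>
      (try (exfalso; clear h3; omega)) <;>
      rcases h3 with (h3 | h3 | h3 | h3 | h3 | h3 | h3 | h3 | h3 | h3 | h3) | h3 | h3 | h3 <;>
      first
        | (exfalso; omega)
        | (left; omega)
        | (right; left; omega)
  · rw [evenQuarticAdj_one hh ha] at h1
    rw [evenQuarticAdj_one hh hb] at h2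
    rcases h1 with h1 | h1 | h1 | h1 <;> rcases h2 with h2 | h2 | h2 | h2 <;>
      (try (exfalso; clear h3; omega)) <;>
      rcases h3 with (h3 | h3 | h3 | h3 | h3 | h3 | h3 | h3 | h3 | h3 | h3) | h3 | h3 | h3 <;>
      (exfalso; omega)
  · rw [evenQuarticAdj_middle hh ha h4] at h1
    rw [evenQuarticAdj_middle hh hb h4] at h2
    rcases h1 with h1 | h1 | h1 | h1 <;> rcases h2 with h2 | h2 | h2 | h2 <;>
      (exfalso; clear h3; omega)
  · omega
  · rw [evenQuarticAdj_quarter hh ha] at h1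
    rw [evenQuarticAdj_quarter hh hb] at h2
    rcases h1 with h1 | h1 | h1 | h1 <;> rcases h2 with h2 | h2 | h2 | h2 <;>
      (try (exfalso; clear h3; omega)) <;>
      rcases h3 with (h3 | h3 | h3 | h3 | h3 | h3 | h3 | h3 | h3 | h3 | h3) | h3 | h3 | h3 <;>
      (exfalso; omega)
  · rw [evenQuarticAdj_three_quarters hh ha] at h1
    rw [evenQuarticAdj_three_quarters hh hb] at h2
    rcases h1 with h1 | h1 | h1 | h1 <;> rcases h2 with h2 | h2 | h2 | h2 <;>
      (exfalso; clear h3; omega)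
  · rw [evenQuarticAdj_low hh ha h4.1 h4.2.1 h4.2.2.1 h4.2.2.2] at h1
    rw [evenQuarticAdj_low hh hb h4.1 h4.2.1 h4.2.2.1 h4.2.2.2] at h2
    rcases h1 with h1 | h1 | h1 | h1 <;> rcases h2 with h2 | h2 | h2 | h2 <;>
      (try (exfalso; clear h3; omega)) <;>
      rcases h3 with (h3 | h3 | h3 | h3 | h3 | h3 | h3 | h3 | h3 | h3 | h3) | h3 | h3 | h3 <;>
      first
        | (exfalso; omega)
        | (left; omega)
        | (right; left; omega)
        | (right; right; left; omega)
        | (right; right; right; left; omega)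
  · rw [evenQuarticAdj_high hh ha h4.1 h4.2.1 h4.2.2] at h1
    rw [evenQuarticAdj_high hh hb h4.1 h4.2.1 h4.2.2] at h2
    rcases h1 with h1 | h1 | h1 | h1 <;> rcases h2 with h2 | h2 | h2 | h2 <;>
      (try (exfalso; clear h3; omega)) <;>
      rcases h3 with (h3 | h3 | h3 | h3 | h3 | h3 | h3 | h3 | h3 | h3 | h3) | h3 | h3 | h3 <;>
      first
        | (exfalso; omega)
        | (left; omega)
        | (right; left; omega)
        | (right; right; left; omega)
        | (right; right; right; left; omega)
        | (right; right; right; right; omega)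

theorem cubicAdj_symm {m x y : ℕ} (hxy : cubicAdj m x y) : cubicAdj m y x := by
  unfold cubicAdj at *
  rcases hxy with h | h | h | h | h | h | h | h | h | h | h
  · exact Or.inr (Or.inl h)
  · exact Or.inl h
  · exact Or.inr (Or.inr (Or.inr (Or.inl h)))
  · exact Or.inr (Or.inr (Or.inl h))
  · exact Or.inr (Or.inr (Or.inr (Or.inr (Or.inr (Or.inl h)))))
  · exact Or.inr (Or.inr (Or.inr (Or.inr (Or.inl h))))
  · exact Or.inr (Or.inr (Or.inr (Or.inr (Or.inr (Or.inr (Or.inr (Or.inl h)))))))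
  · exact Or.inr (Or.inr (Or.inr (Or.inr (Or.inr (Or.inr (Or.inl h))))))
  · iterate 9 right
    left; omega
  · iterate 8 right
    left; omega
  · iterate 10 right
    omega

theorem evenQuarticAdj_symm {h x y : ℕ} (hxy : evenQuarticAdj h x y) : evenQuarticAdj h y x := by
  rcases hxy with hxy | hxy
  · exact Or.inl (cubicAdj_symm hxy)
  · unfold evenExtraAdj at hxy
    rcases hxy with hxy | hxy | hxy
    · exact Or.inr (Or.inr (Or.inl hxy))
    · exact Or.inr (Or.inl hxy)
    · exact Or.inr (Or.inr (Or.inr (by omega)))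

/-- The six triangles of the quartic graph on `4 * h` vertices. -/
theorem evenQuarticAdj_triangle_mem {h v a b : ℕ} (hh : 4 ≤ h) (hv : v < 4 * h) (ha : a < 4 * h)
    (hb : b < 4 * h) (h1 : evenQuarticAdj h v a) (h2 : evenQuarticAdj h v b)
    (h3 : evenQuarticAdj h a b) (hva : v ≠ a) (hvb : v ≠ b) (hab : a ≠ b) :
    ((v = 0 ∨ v = 1 ∨ v + 1 = 2 * h) ∧ (a = 0 ∨ a = 1 ∨ a + 1 = 2 * h) ∧
      (b = 0 ∨ b = 1 ∨ b + 1 = 2 * h)) ∨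
    ((v = 0 ∨ v + 1 = 2 * h ∨ v = 2 * h) ∧ (a = 0 ∨ a + 1 = 2 * h ∨ a = 2 * h) ∧
      (b = 0 ∨ b + 1 = 2 * h ∨ b = 2 * h)) ∨
    ((h ≤ v + 1 ∧ v ≤ h + 1) ∧ (h ≤ a + 1 ∧ a ≤ h + 1) ∧ (h ≤ b + 1 ∧ b ≤ h + 1)) ∨
    ((2 * h ≤ v + 2 ∧ v ≤ 2 * h) ∧ (2 * h ≤ a + 2 ∧ a ≤ 2 * h) ∧
      (2 * h ≤ b + 2 ∧ b ≤ 2 * h)) ∨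
    ((3 * h ≤ v + 1 ∧ v ≤ 3 * h + 1) ∧ (3 * h ≤ a + 1 ∧ a ≤ 3 * h + 1) ∧
      (3 * h ≤ b + 1 ∧ b ≤ 3 * h + 1)) ∨
    (4 * h ≤ v + 3 ∧ 4 * h ≤ a + 3 ∧ 4 * h ≤ b + 3) := by
  have key : ∃ x y z, x < 4 * h ∧ y < 4 * h ∧ z < 4 * h ∧ evenQuarticAdj h x y ∧
      evenQuarticAdj h x z ∧ evenQuarticAdj h y z ∧ x < y ∧ y < z ∧
      (v = x ∨ v = y ∨ v = z) ∧ (a = x ∨ a = y ∨ a = z) ∧ (b = x ∨ b = y ∨ b = z) := by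
    have h1' := evenQuarticAdj_symm h1
    have h2' := evenQuarticAdj_symm h2
    have h3' := evenQuarticAdj_symm h3
    rcases lt_or_gt_of_ne hva with c1 | c1 <;> rcases lt_or_gt_of_ne hvb with c2 | c2 <;>
      rcases lt_or_gt_of_ne hab with c3 | c3
    · exact ⟨v, a, b, by simp [*]⟩
    · exact ⟨v, b, a, by simp [*]⟩
    · omega
    · exact ⟨b, v, a, by simp [*]⟩
    · exact ⟨a, v, b, by simp [*]⟩
    · omega
    · exact ⟨a, b, v, by simp [*]⟩
    · exact ⟨b, a, v, by simp [*]⟩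
  obtain ⟨x, y, z, hx, hy, hz, e1, e2, e3, l1, l2, mv, ma, mb⟩ := key
  rcases evenQuarticAdj_triangle hh hx hy hz e1 e2 e3 l1 l2 with h | h | h | h | h | h
  · exact Or.inl ⟨by omega, by omega, by omega⟩
  · exact Or.inr (Or.inl ⟨by omega, by omega, by omega⟩)
  · exact Or.inr (Or.inr (Or.inl ⟨by omega, by omega, by omega⟩))
  · exact Or.inr (Or.inr (Or.inr (Or.inl ⟨by omega, by omega, by omega⟩)))
  · exact Or.inr (Or.inr (Or.inr (Or.inr (Or.inl ⟨by omega, by omega, by omega⟩))))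
  · exact Or.inr (Or.inr (Or.inr (Or.inr (Or.inr ⟨by omega, by omega, by omega⟩))))

/-- The only triangles sharing edges form the chain `{0, 1, 2h - 1}`, `{0, 2h - 1, 2h}`, `{2h - 2,
2h - 1, 2h}`. The centre is their common vertex `2h - 1`, and `b, c` complete the middle triangle.
-/
theorem evenQuarticAdj_fan {h v a b c d : ℕ} (hh : 4 ≤ h) (hv : v < 4 * h) (ha : a < 4 * h)
    (hb : b < 4 * h) (hc : c < 4 * h) (hd : d < 4 * h)
    (va : evenQuarticAdj h v a) (vb : evenQuarticAdj h v b) (vc : evenQuarticAdj h v c)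
    (vd : evenQuarticAdj h v d) (ab : evenQuarticAdj h a b) (bc : evenQuarticAdj h b c)
    (cd : evenQuarticAdj h c d) (nva : v ≠ a) (nvb : v ≠ b) (nvc : v ≠ c) (nvd : v ≠ d)
    (nab : a ≠ b) (nac : a ≠ c) (nad : a ≠ d) (nbc : b ≠ c) (nbd : b ≠ d) (ncd : c ≠ d) :
    v + 1 = 2 * h ∧ ((b = 0 ∧ c = 2 * h) ∨ (b = 2 * h ∧ c = 0)) := by
  have t1 := evenQuarticAdj_triangle_mem hh hv ha hb va vb ab nva nvb nab
  have t2 := evenQuarticAdj_triangle_mem hh hv hb hc vb vc bc nvb nvc nbc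
  have t3 := evenQuarticAdj_triangle_mem hh hv hc hd vc vd cd nvc nvd ncd
  clear va vb vc vd ab bc cd
  rcases t1 with t1 | t1 | t1 | t1 | t1 | t1 <;> rcases t2 with t2 | t2 | t2 | t2 | t2 | t2 <;>
    (try (exfalso; clear t3; omega)) <;> rcases t3 with t3 | t3 | t3 | t3 | t3 | t3 <;>
    (try (exfalso; omega)) <;> omega

theorem evenQuarticAdj_fixed_seed {h : ℕ} (hh : 4 ≤ h) {s : ℕ → ℕ}
    (H : IsRelAut (4 * h) (evenQuarticAdj h) s) :
    s (2 * h - 1) = 2 * h - 1 ∧ s 0 = 0 ∧ s (2 * h) = 2 * h := by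
  have ne : ∀ x y, x < 4 * h → y < 4 * h → x ≠ y → s x ≠ s y := fun x y hx hy hxy e =>
    hxy (H.inj x hx y hy e)
  have l : ∀ x, x < 4 * h → s x < 4 * h := H.lt
  have adj : ∀ x y, x < 4 * h → y < 4 * h → evenQuarticAdj h x y → evenQuarticAdj h (s x) (s y) :=
    fun x y hx hy h => H.map_rel hx hy h
  have mid : ∀ y < 4 * h, (y = 0 ∨ y + 2 = 2 * h ∨ y = 2 * h ∨ y = 1) →
      evenQuarticAdj h (s (2 * h - 1)) (s y) := fun y hy h' =>
    adj _ _ (by omega) hy ((evenQuarticAdj_middle hh hy (by omega)).mpr h')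
  have fan := evenQuarticAdj_fan hh (l (2 * h - 1) (by omega)) (l 1 (by omega)) (l 0 (by omega))
    (l (2 * h) (by omega)) (l (2 * h - 2) (by omega)) (mid _ (by omega) (by omega))
    (mid _ (by omega) (by omega)) (mid _ (by omega) (by omega)) (mid _ (by omega) (by omega))
    (adj _ _ (by omega) (by omega) ((evenQuarticAdj_one hh (by omega)).mpr (by omega)))
    (adj _ _ (by omega) (by omega) ((evenQuarticAdj_zero hh (by omega)).mpr (by omega)))
    (adj _ _ (by omega) (by omega)
      ((evenQuarticAdj_low hh (by omega) (by omega) (by omega) (by omega) (by omega)).mpr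
        (by omega)))
    (ne _ _ (by omega) (by omega) (by omega)) (ne _ _ (by omega) (by omega) (by omega))
    (ne _ _ (by omega) (by omega) (by omega)) (ne _ _ (by omega) (by omega) (by omega))
    (ne _ _ (by omega) (by omega) (by omega)) (ne _ _ (by omega) (by omega) (by omega))
    (ne _ _ (by omega) (by omega) (by omega)) (ne _ _ (by omega) (by omega) (by omega))
    (ne _ _ (by omega) (by omega) (by omega)) (ne _ _ (by omega) (by omega) (by omega))
  obtain ⟨fm, ⟨f0, f1⟩ | ⟨f0, f1⟩⟩ := fan
  · exact ⟨by omega, f0, f1⟩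
  -- A reversed fan would send `4h - 1`, the neighbour of `0` outside the fan, to `2h + 1`, the
  -- neighbour of `2h` outside it. But `4h - 1` lies on a triangle and `2h + 1` does not.
  · exfalso
    have a1 := adj 0 (4 * h - 1) (by omega) (by omega)
      ((evenQuarticAdj_zero hh (by omega)).mpr (by omega))
    have n1 := ne (4 * h - 1) 0 (by omega) (by omega) (by omega)
    have n2 := ne (4 * h - 1) (2 * h) (by omega) (by omega) (by omega)
    have n3 := ne (4 * h - 1) (2 * h - 1) (by omega) (by omega) (by omega)
    have n4 := ne (4 * h - 1) 1 (by omega) (by omega) (by omega)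
    have b1 := mid 1 (by omega) (by omega)
    have b2 := mid (2 * h - 2) (by omega) (by omega)
    have n5 := ne 1 (2 * h - 2) (by omega) (by omega) (by omega)
    have n6 := ne 1 0 (by omega) (by omega) (by omega)
    have n7 := ne 1 (2 * h) (by omega) (by omega) (by omega)
    have a2 := adj 0 1 (by omega) (by omega) ((evenQuarticAdj_zero hh (by omega)).mpr (by omega))
    have l1 := l 1 (by omega)
    have l2 := l (4 * h - 1) (by omega)
    rw [f0] at a1 a2
    rw [evenQuarticAdj_low hh (by omega) (by omega) (by omega) (by omega) (by omega)] at a1 a2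
    rw [evenQuarticAdj_middle hh l1 fm] at b1
    have e : s (4 * h - 1) = 2 * h + 1 := by omega
    have x1 := adj (4 * h - 1) (4 * h - 2) (by omega) (by omega)
      ((evenQuarticAdj_sub_one hh (by omega) (by omega)).mpr (by omega))
    have x2 := adj (4 * h - 1) (4 * h - 3) (by omega) (by omega)
      ((evenQuarticAdj_sub_one hh (by omega) (by omega)).mpr (by omega))
    have x3 := adj (4 * h - 2) (4 * h - 3) (by omega) (by omega)
      ((evenQuarticAdj_sub_two hh (by omega) (by omega)).mpr (by omega))
    have t := evenQuarticAdj_triangle_mem hh (l _ (by omega)) (l _ (by omega)) (l _ (by omega))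
      x1 x2 x3 (ne _ _ (by omega) (by omega) (by omega)) (ne _ _ (by omega) (by omega) (by omega))
      (ne _ _ (by omega) (by omega) (by omega))
    rw [e] at t
    omega

/-- Accumulates the known fixed vertices in one arithmetic predicate, so that `omega` can check
membership. -/
theorem IsRelAut.fixed_insert {s : ℕ → ℕ} {P : ℕ → Prop} (hP : ∀ x, P x → s x = x) {w : ℕ}
    (hw : s w = w) : ∀ x, (x = w ∨ P x) → s x = x := by
  rintro x (rfl | h)
  · exact hw
  · exact hP x h

theorem evenQuarticAdj_fixed_base {h : ℕ} (hh : 4 ≤ h) {s : ℕ → ℕ}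
    (H : IsRelAut (4 * h) (evenQuarticAdj h) s) :
    ∀ x < 4 * h, (x ≤ 3 ∨ 4 * h ≤ x + 4 ∨ (2 * h ≤ x + 2 ∧ x ≤ 2 * h)) → s x = x := by
  obtain ⟨f1, f2, f3⟩ := evenQuarticAdj_fixed_seed hh H
  have F : ∀ x, (x = 2 * h - 1 ∨ x = 0 ∨ x = 2 * h) → s x = x := by
    rintro x (rfl | rfl | rfl) <;> assumption
  have adjm : ∀ x < 4 * h, (x = 0 ∨ x + 2 = 2 * h ∨ x = 2 * h ∨ x = 1) →
      evenQuarticAdj h (2 * h - 1) (s x) := by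
    intro x hx h'
    have := H.map_rel (by omega) hx ((evenQuarticAdj_middle hh hx (x := 2 * h - 1) (by omega)).mpr h')
    rwa [f1] at this
  have f4 : s 1 = 1 := by
    refine H.fixed_of_common (u := 2 * h - 1) (v := 0) (by omega) (by omega) (by omega) f1 f2
      ((evenQuarticAdj_middle hh (by omega) (by omega)).mpr (by omega))
      ((evenQuarticAdj_zero hh (by omega)).mpr (by omega)) fun y hy a b => ?_
    rw [evenQuarticAdj_middle hh hy (by omega)] at a
    rw [evenQuarticAdj_zero hh hy] at b
    by_cases e : y = 1
    · exact Or.inl e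
    · exact Or.inr (F y (by omega))
  have F := IsRelAut.fixed_insert F f4
  have f5 : s (2 * h - 2) = 2 * h - 2 := by
    refine H.fixed_of_adj (v := 2 * h - 1) (by omega) (by omega) f1
      ((evenQuarticAdj_middle hh (by omega) (by omega)).mpr (by omega)) fun y hy a => ?_
    rw [evenQuarticAdj_middle hh hy (by omega)] at a
    by_cases e : y = 2 * h - 2
    · exact Or.inl e
    · exact Or.inr (F y (by omega))
  have F := IsRelAut.fixed_insert F f5
  have f6 : s (4 * h - 1) = 4 * h - 1 := by
    refine H.fixed_of_adj (v := 0) (by omega) (by omega) f2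
      ((evenQuarticAdj_zero hh (by omega)).mpr (by omega)) fun y hy a => ?_
    rw [evenQuarticAdj_zero hh hy] at a
    by_cases e : y = 4 * h - 1
    · exact Or.inl e
    · exact Or.inr (F y (by omega))
  have F := IsRelAut.fixed_insert F f6
  have f7 : s (2 * h + 1) = 2 * h + 1 := by
    refine H.fixed_of_adj (v := 2 * h) (by omega) (by omega) f3
      ((evenQuarticAdj_low hh (by omega) (by omega) (by omega) (by omega) (by omega)).mpr
        (by omega)) fun y hy a => ?_
    rw [evenQuarticAdj_low hh hy (by omega) (by omega) (by omega) (by omega)] at a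
    by_cases e : y = 2 * h + 1
    · exact Or.inl e
    · exact Or.inr (F y (by omega))
  have F := IsRelAut.fixed_insert F f7
  have f8 : s 2 = 2 := by
    refine H.fixed_of_common (u := 1) (v := 2 * h - 2) (by omega) (by omega) (by omega) f4 f5
      ((evenQuarticAdj_one hh (by omega)).mpr (by omega))
      ((evenQuarticAdj_low hh (by omega) (by omega) (by omega) (by omega) (by omega)).mpr
        (by omega)) fun y hy a b => ?_
    rw [evenQuarticAdj_one hh hy] at a
    rw [evenQuarticAdj_low hh hy (by omega) (by omega) (by omega) (by omega)] at b
    by_cases e : y = 2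
    · exact Or.inl e
    · exact Or.inr (F y (by omega))
  have F := IsRelAut.fixed_insert F f8
  have f9 : s (4 * h - 2) = 4 * h - 2 := by
    refine H.fixed_of_adj (v := 1) (by omega) (by omega) f4
      ((evenQuarticAdj_one hh (by omega)).mpr (by omega)) fun y hy a => ?_
    rw [evenQuarticAdj_one hh hy] at a
    by_cases e : y = 4 * h - 2
    · exact Or.inl e
    · exact Or.inr (F y (by omega))
  have F := IsRelAut.fixed_insert F f9
  have f10 : s (2 * h - 3) = 2 * h - 3 := by
    refine H.fixed_of_adj (v := 2 * h - 2) (by omega) (by omega) f5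
      ((evenQuarticAdj_low hh (by omega) (by omega) (by omega) (by omega) (by omega)).mpr
        (by omega)) fun y hy a => ?_
    rw [evenQuarticAdj_low hh hy (by omega) (by omega) (by omega) (by omega)] at a
    by_cases e : y = 2 * h - 3
    · exact Or.inl e
    · exact Or.inr (F y (by omega))
  have F := IsRelAut.fixed_insert F f10
  have f11 : s (4 * h - 3) = 4 * h - 3 := by
    refine H.fixed_of_adj (v := 4 * h - 1) (by omega) (by omega) f6
      ((evenQuarticAdj_sub_one hh (by omega) (by omega)).mpr (by omega)) fun y hy a => ?_
    rw [evenQuarticAdj_sub_one hh hy (by omega)] at a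
    by_cases e : y = 4 * h - 3
    · exact Or.inl e
    · exact Or.inr (F y (by omega))
  have F := IsRelAut.fixed_insert F f11
  have f12 : s 3 = 3 := by
    refine H.fixed_of_common (u := 2) (v := 2 * h - 3) (by omega) (by omega) (by omega) f8 f10
      ((evenQuarticAdj_low hh (by omega) (by omega) (by omega) (by omega) (by omega)).mpr
        (by omega))
      ((evenQuarticAdj_low hh (by omega) (by omega) (by omega) (by omega) (by omega)).mpr
        (by omega)) fun y hy a b => ?_
    rw [evenQuarticAdj_low hh hy (by omega) (by omega) (by omega) (by omega)] at a b
    by_cases e : y = 3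
    · exact Or.inl e
    · exact Or.inr (F y (by omega))
  have F := IsRelAut.fixed_insert F f12
  have f13 : s (4 * h - 4) = 4 * h - 4 := by
    refine H.fixed_of_adj (v := 2) (by omega) (by omega) f8
      ((evenQuarticAdj_low hh (by omega) (by omega) (by omega) (by omega) (by omega)).mpr
        (by omega)) fun y hy a => ?_
    rw [evenQuarticAdj_low hh hy (by omega) (by omega) (by omega) (by omega)] at a
    by_cases e : y = 4 * h - 4
    · exact Or.inl e
    · exact Or.inr (F y (by omega))
  have F := IsRelAut.fixed_insert F f13
  intro x hx hx'
  exact F x (by omega)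

/-- Three fixed segments grow together: up from `0`, down from `4h - 1`, and down from `2h`. The
outermost vertex `k + 3` has three unfixed neighbours; two are also neighbours of the ends of the
other segments, and once these are fixed the third, `k + 4`, is forced. -/
theorem evenQuarticAdj_fixed_segments {h : ℕ} (hh : 4 ≤ h) {s : ℕ → ℕ}
    (H : IsRelAut (4 * h) (evenQuarticAdj h) s) (k : ℕ) (hk : k + 4 ≤ h) :
    ∀ x < 4 * h, (x ≤ k + 3 ∨ 4 * h ≤ x + k + 4 ∨ (2 * h ≤ x + k + 2 ∧ x ≤ 2 * h)) → s x = x := by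
  induction k with
  | zero => exact evenQuarticAdj_fixed_base hh H
  | succ k ih =>
    have ih := ih (by omega)
    have f1 : s (2 * h - 3 - k) = 2 * h - 3 - k := by
      refine H.fixed_of_common (u := k + 3) (v := 2 * h - 2 - k) (by omega) (by omega) (by omega)
        (ih _ (by omega) (by omega)) (ih _ (by omega) (by omega))
        ((evenQuarticAdj_low hh (by omega) (by omega) (by omega) (by omega) (by omega)).mpr
          (by omega))
        ((evenQuarticAdj_low hh (by omega) (by omega) (by omega) (by omega) (by omega)).mpr
          (by omega)) fun y hy a b => ?_
      rw [evenQuarticAdj_low hh hy (by omega) (by omega) (by omega) (by omega)] at a b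
      by_cases e : y = 2 * h - 3 - k
      · exact Or.inl e
      · exact Or.inr (ih y hy (by omega))
    have f2 : s (4 * h - 5 - k) = 4 * h - 5 - k := by
      refine H.fixed_of_common (u := k + 3) (v := 4 * h - 4 - k) (by omega) (by omega) (by omega)
        (ih _ (by omega) (by omega)) (ih _ (by omega) (by omega))
        ((evenQuarticAdj_low hh (by omega) (by omega) (by omega) (by omega) (by omega)).mpr
          (by omega))
        ((evenQuarticAdj_high hh (by omega) (by omega) (by omega) (by omega)).mpr
          (by omega)) fun y hy a b => ?_
      rw [evenQuarticAdj_low hh hy (by omega) (by omega) (by omega) (by omega)] at a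
      rw [evenQuarticAdj_high hh hy (by omega) (by omega) (by omega)] at b
      by_cases e : y = 4 * h - 5 - k
      · exact Or.inl e
      · exact Or.inr (ih y hy (by omega))
    have f3 : s (k + 4) = k + 4 := by
      refine H.fixed_of_adj (v := k + 3) (by omega) (by omega) (ih _ (by omega) (by omega))
        ((evenQuarticAdj_low hh (by omega) (by omega) (by omega) (by omega) (by omega)).mpr
          (by omega)) fun y hy a => ?_
      rw [evenQuarticAdj_low hh hy (by omega) (by omega) (by omega) (by omega)] at a
      rcases a with a | a | a | a
      · exact Or.inr (ih y hy (by omega))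
      · exact Or.inl (by omega)
      · exact Or.inr ((by omega : y = 4 * h - 5 - k) ▸ f2)
      · exact Or.inr ((by omega : y = 2 * h - 3 - k) ▸ f1)
    intro x hx hx'
    by_cases c : x ≤ k + 3 ∨ 4 * h ≤ x + k + 4 ∨ (2 * h ≤ x + k + 2 ∧ x ≤ 2 * h)
    · exact ih x hx c
    · rcases (by omega : x = k + 4 ∨ x = 4 * h - 5 - k ∨ x = 2 * h - 3 - k) with rfl | rfl | rfl <;>
        assumption

theorem evenQuarticAdj_fixed {h : ℕ} (hh : 4 ≤ h) {s : ℕ → ℕ}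
    (H : IsRelAut (4 * h) (evenQuarticAdj h) s) : ∀ x < 4 * h, s x = x := by
  -- The value `k = h - 4` leaves only `h`, `h + 1` and the interval from `2h + 1` to `3h - 1`.
  have F : ∀ x, x < 4 * h ∧ (x + 1 ≤ h ∨ 3 * h ≤ x ∨ (h + 2 ≤ x ∧ x ≤ 2 * h)) → s x = x :=
    fun x hx => evenQuarticAdj_fixed_segments hh H (h - 4) (by omega) x hx.1 (by omega)
  have f1 : s (h + 1) = h + 1 := by
    refine H.fixed_of_common (u := h - 1) (v := h + 2) (by omega) (by omega) (by omega)
      (F _ (by omega)) (F _ (by omega))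
      ((evenQuarticAdj_low hh (by omega) (by omega) (by omega) (by omega) (by omega)).mpr
        (by omega))
      ((evenQuarticAdj_low hh (by omega) (by omega) (by omega) (by omega) (by omega)).mpr
        (by omega)) fun y hy a b => ?_
    rw [evenQuarticAdj_low hh hy (by omega) (by omega) (by omega) (by omega)] at a b
    by_cases e : y = h + 1
    · exact Or.inl e
    · exact Or.inr (F y (by omega))
  have F := IsRelAut.fixed_insert F f1
  have f2 : s h = h := by
    refine H.fixed_of_common (u := h - 1) (v := h + 1) (by omega) (by omega) (by omega)
      (F _ (by omega)) f1
      ((evenQuarticAdj_low hh (by omega) (by omega) (by omega) (by omega) (by omega)).mpr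
        (by omega))
      ((evenQuarticAdj_low hh (by omega) (by omega) (by omega) (by omega) (by omega)).mpr
        (by omega)) fun y hy a b => ?_
    rw [evenQuarticAdj_low hh hy (by omega) (by omega) (by omega) (by omega)] at a b
    by_cases e : y = h
    · exact Or.inl e
    · exact Or.inr (F y (by omega))
  have F := IsRelAut.fixed_insert F f2
  have f3 : s (3 * h - 2) = 3 * h - 2 := by
    refine H.fixed_of_adj (v := h) (by omega) (by omega) f2
      ((evenQuarticAdj_quarter hh (by omega)).mpr (by omega)) fun y hy a => ?_
    rw [evenQuarticAdj_quarter hh hy] at a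
    by_cases e : y = 3 * h - 2
    · exact Or.inl e
    · exact Or.inr (F y (by omega))
  have F := IsRelAut.fixed_insert F f3
  have f4 : s (3 * h - 1) = 3 * h - 1 := by
    refine H.fixed_of_adj (v := h - 1) (by omega) (by omega) (F _ (by omega))
      ((evenQuarticAdj_low hh (by omega) (by omega) (by omega) (by omega) (by omega)).mpr
        (by omega)) fun y hy a => ?_
    rw [evenQuarticAdj_low hh hy (by omega) (by omega) (by omega) (by omega)] at a
    by_cases e : y = 3 * h - 1
    · exact Or.inl e
    · exact Or.inr (F y (by omega))
  have F := IsRelAut.fixed_insert F f4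
  intro x hx
  by_cases c : 2 * h < x ∧ x + 3 ≤ 3 * h
  -- The rung partner of `x` lies below `2h`, and so do all its neighbours other than `x`; these are
  -- already fixed.
  · refine H.fixed_of_adj (v := 4 * h - 2 - x) (by omega) hx (F _ (by omega))
      ((evenQuarticAdj_low hh (by omega) (by omega) (by omega) (by omega) (by omega)).mpr
        (by omega)) fun y hy a => ?_
    rw [evenQuarticAdj_low hh hy (by omega) (by omega) (by omega) (by omega)] at a
    by_cases e : y = x
    · exact Or.inl e
    · exact Or.inr (F y (by omega))
  · exact F x (by omega)

/-! ### Neighbourhoods in the quartic graph on `2 * m` vertices, `m` odd -/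

section oddQuarticNeighbours

variable {m x y : ℕ}

theorem oddExtraAdj_iff (hm : 6 ≤ m) (h2 : 2 < x)
    (hx' : x ≠ m + 1) : oddExtraAdj m x y ↔ x + y = 2 * m + 2 := by unfold oddExtraAdj; omega

theorem oddQuarticAdj_zero (hm : 9 ≤ m) (hy : y < 2 * m) :
    oddQuarticAdj m 0 y ↔ y = 1 ∨ y + 1 = 2 * m ∨ y + 1 = m ∨ y = 2 := by
  rw [oddQuarticAdj, cubicAdj_zero (by omega) (by omega)]
  unfold oddExtraAdj
  omega

theorem oddQuarticAdj_one (hm : 9 ≤ m) (hy : y < 2 * m) :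
    oddQuarticAdj m 1 y ↔ y = 0 ∨ y = 2 ∨ y + 2 = 2 * m ∨ y = m + 1 := by
  rw [oddQuarticAdj, cubicAdj_one (by omega) (by omega)]
  unfold oddExtraAdj
  omega

theorem oddQuarticAdj_two (hm : 9 ≤ m) (hy : y < 2 * m) :
    oddQuarticAdj m 2 y ↔ y = 1 ∨ y = 3 ∨ y + 4 = 2 * m ∨ y = 0 := by
  rw [oddQuarticAdj, cubicAdj_generic (by omega) (by omega) (by omega) (by omega)]
  unfold oddExtraAdj
  omega

theorem oddQuarticAdj_middle (hm : 9 ≤ m) (hy : y < 2 * m) (hx : x + 1 = m) :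
    oddQuarticAdj m x y ↔ y = 0 ∨ y + 2 = m ∨ y = m ∨ y = m + 3 := by
  rw [oddQuarticAdj, cubicAdj_middle (by omega) hx,
    oddExtraAdj_iff (by omega) (by omega) (by omega)]
  omega

theorem oddQuarticAdj_succ_middle (hm : 9 ≤ m) (hy : y < 2 * m) :
    oddQuarticAdj m (m + 1) y ↔ y = m ∨ y = m + 2 ∨ y + 3 = m ∨ y = 1 := by
  rw [oddQuarticAdj, cubicAdj_generic (by omega) (by omega) (by omega) (by omega)]
  unfold oddExtraAdj
  omega

theorem oddQuarticAdj_sub_one (hm : 9 ≤ m) (hy : y < 2 * m) (hx : x + 1 = 2 * m) :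
    oddQuarticAdj m x y ↔ y = 0 ∨ y + 2 = 2 * m ∨ y + 3 = 2 * m ∨ y = 3 := by
  rw [oddQuarticAdj, cubicAdj_sub_one (by omega) (by omega) (by omega),
    oddExtraAdj_iff (by omega) (by omega) (by omega)]
  omega

theorem oddQuarticAdj_sub_two (hm : 9 ≤ m) (hy : y < 2 * m) (hx : x + 2 = 2 * m) :
    oddQuarticAdj m x y ↔ y = 1 ∨ y + 1 = 2 * m ∨ y + 3 = 2 * m ∨ y = 4 := by
  rw [oddQuarticAdj, cubicAdj_sub_two (by omega) (by omega) (by omega),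
    oddExtraAdj_iff (by omega) (by omega) (by omega)]
  omega

theorem oddQuarticAdj_sub_three (hm : 9 ≤ m) (hy : y < 2 * m) (hx : x + 3 = 2 * m) :
    oddQuarticAdj m x y ↔ y + 1 = 2 * m ∨ y + 2 = 2 * m ∨ y + 4 = 2 * m ∨ y = 5 := by
  rw [oddQuarticAdj, cubicAdj_sub_three (by omega) (by omega) (by omega),
    oddExtraAdj_iff (by omega) (by omega) (by omega)]
  omega

theorem oddQuarticAdj_generic (hm : 9 ≤ m) (hy : y < 2 * m) (h3 : 3 ≤ x) (hx : x + 4 ≤ 2 * m)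
    (hxm : x + 1 ≠ m) (hxm' : x ≠ m + 1) :
    oddQuarticAdj m x y ↔ y + 1 = x ∨ y = x + 1 ∨ x + y + 2 = 2 * m ∨ x + y = 2 * m + 2 := by
  rw [oddQuarticAdj, cubicAdj_generic (by omega) (by omega) (by omega) (by omega),
    oddExtraAdj_iff (by omega) (by omega) (by omega)]
  omega

end oddQuarticNeighbours

theorem oddQuarticAdj_symm {m x y : ℕ} (hxy : oddQuarticAdj m x y) : oddQuarticAdj m y x := by
  rcases hxy with h | h
  · exact Or.inl (cubicAdj_symm h)
  · unfold oddExtraAdj at h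
    rcases h with h | h | h
    · exact Or.inr (Or.inr (Or.inl h))
    · exact Or.inr (Or.inl h)
    · exact Or.inr (Or.inr (Or.inr (by omega)))

/-! ### The quartic graph on `2 * m` vertices, `m` odd, is asymmetric -/

theorem oddQuarticAdj_triangle {m v a b : ℕ} (hm : 9 ≤ m) (hodd : m % 2 = 1) (hv : v < 2 * m)
    (ha : a < 2 * m) (hb : b < 2 * m) (h1 : oddQuarticAdj m v a) (h2 : oddQuarticAdj m v b)
    (h3 : oddQuarticAdj m a b) (hva : v < a) (hab : a < b) :
    (v = 0 ∧ a = 1 ∧ b = 2) ∨ (v + 2 = m ∧ a + 1 = m ∧ b = m) ∨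
    (v = m ∧ a = m + 1 ∧ b = m + 2) ∨ (v + 3 = 2 * m ∧ a + 2 = 2 * m ∧ b + 1 = 2 * m) := by
  unfold oddQuarticAdj cubicAdj oddExtraAdj at h3
  rcases (by omega : v = 0 ∨ v = 1 ∨ v = 2 ∨ v + 1 = m ∨ v = m + 1 ∨ v + 3 = 2 * m ∨
    (3 ≤ v ∧ v + 4 ≤ 2 * m ∧ v + 1 ≠ m ∧ v ≠ m + 1)) with
    rfl | rfl | rfl | h4 | rfl | h4 | h4
  · rw [oddQuarticAdj_zero hm ha] at h1
    rw [oddQuarticAdj_zero hm hb] at h2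
    rcases h1 with h1 | h1 | h1 | h1 <;> rcases h2 with h2 | h2 | h2 | h2 <;>
      (try (exfalso; clear h3; omega)) <;>
      rcases h3 with (h3 | h3 | h3 | h3 | h3 | h3 | h3 | h3 | h3 | h3 | h3) | h3 | h3 | h3 <;>
      first
        | (exfalso; omega)
        | (left; omega)
  · rw [oddQuarticAdj_one hm ha] at h1
    rw [oddQuarticAdj_one hm hb] at h2
    rcases h1 with h1 | h1 | h1 | h1 <;> rcases h2 with h2 | h2 | h2 | h2 <;>
      (try (exfalso; clear h3; omega)) <;>
      rcases h3 with (h3 | h3 | h3 | h3 | h3 | h3 | h3 | h3 | h3 | h3 | h3) | h3 | h3 | h3 <;>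
      (exfalso; omega)
  · rw [oddQuarticAdj_two hm ha] at h1
    rw [oddQuarticAdj_two hm hb] at h2
    rcases h1 with h1 | h1 | h1 | h1 <;> rcases h2 with h2 | h2 | h2 | h2 <;>
      (try (exfalso; clear h3; omega)) <;>
      rcases h3 with (h3 | h3 | h3 | h3 | h3 | h3 | h3 | h3 | h3 | h3 | h3) | h3 | h3 | h3 <;>
      (exfalso; omega)
  · rw [oddQuarticAdj_middle hm ha h4] at h1
    rw [oddQuarticAdj_middle hm hb h4] at h2
    rcases h1 with h1 | h1 | h1 | h1 <;> rcases h2 with h2 | h2 | h2 | h2 <;>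
      (try (exfalso; clear h3; omega)) <;>
      rcases h3 with (h3 | h3 | h3 | h3 | h3 | h3 | h3 | h3 | h3 | h3 | h3) | h3 | h3 | h3 <;>
      (exfalso; omega)
  · rw [oddQuarticAdj_succ_middle hm ha] at h1
    rw [oddQuarticAdj_succ_middle hm hb] at h2
    rcases h1 with h1 | h1 | h1 | h1 <;> rcases h2 with h2 | h2 | h2 | h2 <;>
      (exfalso; clear h3; omega)
  · omega
  · rw [oddQuarticAdj_generic hm ha h4.1 h4.2.1 h4.2.2.1 h4.2.2.2] at h1
    rw [oddQuarticAdj_generic hm hb h4.1 h4.2.1 h4.2.2.1 h4.2.2.2] at h2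
    rcases h1 with h1 | h1 | h1 | h1 <;> rcases h2 with h2 | h2 | h2 | h2 <;>
      (try (exfalso; clear h3; omega)) <;>
      rcases h3 with (h3 | h3 | h3 | h3 | h3 | h3 | h3 | h3 | h3 | h3 | h3) | h3 | h3 | h3 <;>
      first
        | (exfalso; omega)
        | (left; omega)
        | (right; left; omega)
        | (right; right; left; omega)

/-- The four triangles of the quartic graph on `2 * m` vertices, `m` odd. -/
theorem oddQuarticAdj_triangle_mem {m v a b : ℕ} (hm : 9 ≤ m) (hodd : m % 2 = 1) (hv : v < 2 * m)
    (ha : a < 2 * m) (hb : b < 2 * m) (h1 : oddQuarticAdj m v a) (h2 : oddQuarticAdj m v b)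
    (h3 : oddQuarticAdj m a b) (hva : v ≠ a) (hvb : v ≠ b) (hab : a ≠ b) :
    (v ≤ 2 ∧ a ≤ 2 ∧ b ≤ 2) ∨
    ((m ≤ v + 2 ∧ v ≤ m) ∧ (m ≤ a + 2 ∧ a ≤ m) ∧ (m ≤ b + 2 ∧ b ≤ m)) ∨
    ((m ≤ v ∧ v ≤ m + 2) ∧ (m ≤ a ∧ a ≤ m + 2) ∧ (m ≤ b ∧ b ≤ m + 2)) ∨
    (2 * m ≤ v + 3 ∧ 2 * m ≤ a + 3 ∧ 2 * m ≤ b + 3) := by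
  have key : ∃ x y z, x < 2 * m ∧ y < 2 * m ∧ z < 2 * m ∧ oddQuarticAdj m x y ∧
      oddQuarticAdj m x z ∧ oddQuarticAdj m y z ∧ x < y ∧ y < z ∧
      (v = x ∨ v = y ∨ v = z) ∧ (a = x ∨ a = y ∨ a = z) ∧ (b = x ∨ b = y ∨ b = z) := by
    have h1' := oddQuarticAdj_symm h1
    have h2' := oddQuarticAdj_symm h2
    have h3' := oddQuarticAdj_symm h3
    rcases lt_or_gt_of_ne hva with c1 | c1 <;> rcases lt_or_gt_of_ne hvb with c2 | c2 <;>
      rcases lt_or_gt_of_ne hab with c3 | c3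
    · exact ⟨v, a, b, by simp [*]⟩
    · exact ⟨v, b, a, by simp [*]⟩
    · omega
    · exact ⟨b, v, a, by simp [*]⟩
    · exact ⟨a, v, b, by simp [*]⟩
    · omega
    · exact ⟨a, b, v, by simp [*]⟩
    · exact ⟨b, a, v, by simp [*]⟩
  obtain ⟨x, y, z, hx, hy, hz, e1, e2, e3, l1, l2, mv, ma, mb⟩ := key
  rcases oddQuarticAdj_triangle hm hodd hx hy hz e1 e2 e3 l1 l2 with h | h | h | h
  · exact Or.inl ⟨by omega, by omega, by omega⟩
  · exact Or.inr (Or.inl ⟨by omega, by omega, by omega⟩)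
  · exact Or.inr (Or.inr (Or.inl ⟨by omega, by omega, by omega⟩))
  · exact Or.inr (Or.inr (Or.inr ⟨by omega, by omega, by omega⟩))

/-- Among the four triangles only `{m - 2, m - 1, m}` and `{m, m + 1, m + 2}` intersect, and they do
so in `m` alone. -/
theorem oddQuarticAdj_bowtie {m v a b c d : ℕ} (hm : 9 ≤ m) (hodd : m % 2 = 1) (hv : v < 2 * m)
    (ha : a < 2 * m) (hb : b < 2 * m) (hc : c < 2 * m) (hd : d < 2 * m)
    (va : oddQuarticAdj m v a) (vb : oddQuarticAdj m v b) (vc : oddQuarticAdj m v c)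
    (vd : oddQuarticAdj m v d) (ab : oddQuarticAdj m a b) (cd : oddQuarticAdj m c d)
    (nva : v ≠ a) (nvb : v ≠ b) (nvc : v ≠ c) (nvd : v ≠ d) (nab : a ≠ b) (nac : a ≠ c)
    (nad : a ≠ d) (nbc : b ≠ c) (nbd : b ≠ d) (ncd : c ≠ d) :
    v = m ∧ ((m ≤ a + 2 ∧ a ≤ m ∧ m ≤ b + 2 ∧ b ≤ m ∧ m ≤ c ∧ c ≤ m + 2 ∧ m ≤ d ∧ d ≤ m + 2) ∨
      (m ≤ c + 2 ∧ c ≤ m ∧ m ≤ d + 2 ∧ d ≤ m ∧ m ≤ a ∧ a ≤ m + 2 ∧ m ≤ b ∧ b ≤ m + 2)) := by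
  have t1 := oddQuarticAdj_triangle_mem hm hodd hv ha hb va vb ab nva nvb nab
  have t2 := oddQuarticAdj_triangle_mem hm hodd hv hc hd vc vd cd nvc nvd ncd
  clear va vb vc vd ab cd
  rcases t1 with t1 | t1 | t1 | t1 <;> rcases t2 with t2 | t2 | t2 | t2 <;>
    first
      | (exfalso; omega)
      | exact ⟨by omega, Or.inl (by omega)⟩
      | exact ⟨by omega, Or.inr (by omega)⟩

theorem oddQuarticAdj_fixed_seed {m : ℕ} (hm : 9 ≤ m) (hodd : m % 2 = 1) {s : ℕ → ℕ}
    (H : IsRelAut (2 * m) (oddQuarticAdj m) s) :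
    s m = m ∧ s 0 = 0 ∧ s 1 = 1 ∧ s 2 = 2 ∧ s (m - 1) = m - 1 ∧ s (m + 1) = m + 1 := by
  have ne : ∀ x y, x < 2 * m → y < 2 * m → x ≠ y → s x ≠ s y := fun x y hx hy hxy e =>
    hxy (H.inj x hx y hy e)
  have l : ∀ x, x < 2 * m → s x < 2 * m := H.lt
  have adj : ∀ x y, x < 2 * m → y < 2 * m → oddQuarticAdj m x y → oddQuarticAdj m (s x) (s y) :=
    fun x y hx hy h => H.map_rel hx hy h
  have mid : ∀ y < 2 * m, (y + 1 = m ∨ y = m + 1 ∨ m + y + 2 = 2 * m ∨ m + y = 2 * m + 2) →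
      oddQuarticAdj m (s m) (s y) := fun y hy h' =>
    adj _ _ (by omega) hy
      ((oddQuarticAdj_generic hm hy (by omega) (by omega) (by omega) (by omega)).mpr h')
  have bow := oddQuarticAdj_bowtie hm hodd (l m (by omega)) (l (m - 1) (by omega))
    (l (m - 2) (by omega)) (l (m + 1) (by omega)) (l (m + 2) (by omega))
    (mid _ (by omega) (by omega)) (mid _ (by omega) (by omega)) (mid _ (by omega) (by omega))
    (mid _ (by omega) (by omega))
    (adj _ _ (by omega) (by omega) ((oddQuarticAdj_middle hm (by omega) (by omega)).mpr (by omega)))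
    (adj _ _ (by omega) (by omega) ((oddQuarticAdj_succ_middle hm (by omega)).mpr (by omega)))
    (ne _ _ (by omega) (by omega) (by omega)) (ne _ _ (by omega) (by omega) (by omega))
    (ne _ _ (by omega) (by omega) (by omega)) (ne _ _ (by omega) (by omega) (by omega))
    (ne _ _ (by omega) (by omega) (by omega)) (ne _ _ (by omega) (by omega) (by omega))
    (ne _ _ (by omega) (by omega) (by omega)) (ne _ _ (by omega) (by omega) (by omega))
    (ne _ _ (by omega) (by omega) (by omega)) (ne _ _ (by omega) (by omega) (by omega))
  obtain ⟨fm, bow⟩ := bow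
  have n01 := ne 0 1 (by omega) (by omega) (by omega)
  have n02 := ne 0 2 (by omega) (by omega) (by omega)
  have n12 := ne 1 2 (by omega) (by omega) (by omega)
  have a01 := adj 0 1 (by omega) (by omega) ((oddQuarticAdj_zero hm (by omega)).mpr (by omega))
  have t := oddQuarticAdj_triangle_mem hm hodd (l 0 (by omega)) (l 1 (by omega)) (l 2 (by omega))
    a01
    (adj _ _ (by omega) (by omega) ((oddQuarticAdj_zero hm (by omega)).mpr (by omega)))
    (adj _ _ (by omega) (by omega) ((oddQuarticAdj_one hm (by omega)).mpr (by omega)))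
    n01 n02 n12
  have nm0 := ne 0 m (by omega) (by omega) (by omega)
  have nm1 := ne 1 m (by omega) (by omega) (by omega)
  have nm2 := ne 2 m (by omega) (by omega) (by omega)
  have nm3 := ne (m - 1) m (by omega) (by omega) (by omega)
  have nm4 := ne (m + 1) m (by omega) (by omega) (by omega)
  have nm5 := ne (m - 1) (m + 1) (by omega) (by omega) (by omega)
  have b0 := adj 0 (m - 1) (by omega) (by omega)
    ((oddQuarticAdj_zero hm (by omega)).mpr (by omega))
  have b1 := adj 1 (m + 1) (by omega) (by omega)
    ((oddQuarticAdj_one hm (by omega)).mpr (by omega))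
  have lm1 := l (m - 1) (by omega)
  have lm2 := l (m + 1) (by omega)
  have range1 : s (m - 1) + 2 = m ∨ s (m - 1) + 1 = m ∨ s (m - 1) = m + 1 ∨ s (m - 1) = m + 2 := by
    omega
  have range2 : s (m + 1) + 2 = m ∨ s (m + 1) + 1 = m ∨ s (m + 1) = m + 1 ∨ s (m + 1) = m + 2 := by
    omega
  -- The only edges from the triangles `{0, 1, 2}` and `{2m - 3, 2m - 2, 2m - 1}` to the bowtie
  -- without its centre are `0, m - 1` and `1, m + 1`. Hence these two edges are either kept or
  -- swapped.
  have image : ∀ u w, u < 2 * m → w < 2 * m → (u ≤ 2 ∨ 2 * m ≤ u + 3) →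
      (w + 2 = m ∨ w + 1 = m ∨ w = m + 1 ∨ w = m + 2) → oddQuarticAdj m u w →
      (u = 0 ∧ w = m - 1) ∨ (u = 1 ∧ w = m + 1) := by
    intro u w hu hw hu' hw' h
    rcases (by omega : u = 0 ∨ u = 1 ∨ u = 2 ∨ u + 3 = 2 * m ∨ u + 2 = 2 * m ∨ u + 1 = 2 * m) with
      rfl | rfl | rfl | e | e | e
    · rw [oddQuarticAdj_zero hm hw] at h; omega
    · rw [oddQuarticAdj_one hm hw] at h; omega
    · rw [oddQuarticAdj_two hm hw] at h; omega
    · rw [oddQuarticAdj_sub_three hm hw e] at h; omega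
    · rw [oddQuarticAdj_sub_two hm hw e] at h; omega
    · rw [oddQuarticAdj_sub_one hm hw e] at h; omega
  have t' : (s 0 ≤ 2 ∧ s 1 ≤ 2 ∧ s 2 ≤ 2) ∨
      (2 * m ≤ s 0 + 3 ∧ 2 * m ≤ s 1 + 3 ∧ 2 * m ≤ s 2 + 3) := by
    clear bow range1 range2
    omega
  have i0 := image _ _ (l 0 (by omega)) lm1 (by omega) range1 b0
  have i1 := image _ _ (l 1 (by omega)) lm2 (by omega) range2 b1
  clear bow range1 range2 t image
  by_cases c : s 0 = 0
  · exact ⟨fm, by omega, by omega, by omega, by omega, by omega⟩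
  -- In the swapped case `2m - 1` goes to `2m - 2`, and `3`, a common neighbour of `2` and `2m - 1`,
  -- must go to a common neighbour of `2` and `2m - 2`. The only one is `1`, already the image of
  -- `0`.
  · exfalso
    obtain ⟨f0, f1, f2, f3, f4⟩ : s 0 = 1 ∧ s 1 = 0 ∧ s 2 = 2 ∧ s (m - 1) = m + 1 ∧
        s (m + 1) = m - 1 := ⟨by omega, by omega, by omega, by omega, by omega⟩
    have c1 := adj 0 (2 * m - 1) (by omega) (by omega)
      ((oddQuarticAdj_zero hm (by omega)).mpr (by omega))
    have c2 := adj 2 3 (by omega) (by omega) ((oddQuarticAdj_two hm (by omega)).mpr (by omega))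
    have c3 := adj (2 * m - 1) 3 (by omega) (by omega)
      ((oddQuarticAdj_sub_one hm (by omega) (by omega)).mpr (by omega))
    have n1 := ne (2 * m - 1) 1 (by omega) (by omega) (by omega)
    have n2 := ne (2 * m - 1) 2 (by omega) (by omega) (by omega)
    have n3 := ne (2 * m - 1) (m - 1) (by omega) (by omega) (by omega)
    have n4 := ne 3 0 (by omega) (by omega) (by omega)
    have n5 := ne 3 1 (by omega) (by omega) (by omega)
    have l3 := l 3 (by omega)
    rw [f0, oddQuarticAdj_one hm (l _ (by omega))] at c1
    rw [f2, oddQuarticAdj_two hm l3] at c2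
    have e : s (2 * m - 1) + 2 = 2 * m := by omega
    rw [oddQuarticAdj_sub_two hm l3 e] at c3
    omega

theorem oddQuarticAdj_fixed_base {m : ℕ} (hm : 9 ≤ m) (hodd : m % 2 = 1) {s : ℕ → ℕ}
    (H : IsRelAut (2 * m) (oddQuarticAdj m) s) :
    ∀ x < 2 * m, (x ≤ 5 ∨ 2 * m ≤ x + 5) → s x = x := by
  obtain ⟨-, f0, f1, f2, f3, f4⟩ := oddQuarticAdj_fixed_seed hm hodd H
  have F : ∀ x, (x = 0 ∨ x = 1 ∨ x = 2 ∨ x = m - 1 ∨ x = m + 1) → s x = x := by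
    rintro x (rfl | rfl | rfl | rfl | rfl) <;> assumption
  have f5 : s (2 * m - 1) = 2 * m - 1 := by
    refine H.fixed_of_adj (v := 0) (by omega) (by omega) f0
      ((oddQuarticAdj_zero hm (by omega)).mpr (by omega)) fun y hy a => ?_
    rw [oddQuarticAdj_zero hm hy] at a
    by_cases e : y = 2 * m - 1
    · exact Or.inl e
    · exact Or.inr (F y (by omega))
  have F := IsRelAut.fixed_insert F f5
  have f6 : s (2 * m - 2) = 2 * m - 2 := by
    refine H.fixed_of_adj (v := 1) (by omega) (by omega) f1
      ((oddQuarticAdj_one hm (by omega)).mpr (by omega)) fun y hy a => ?_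
    rw [oddQuarticAdj_one hm hy] at a
    by_cases e : y = 2 * m - 2
    · exact Or.inl e
    · exact Or.inr (F y (by omega))
  have F := IsRelAut.fixed_insert F f6
  have f7 : s (2 * m - 3) = 2 * m - 3 := by
    refine H.fixed_of_common (u := 2 * m - 1) (v := 2 * m - 2) (by omega) (by omega) (by omega)
      f5 f6 ((oddQuarticAdj_sub_one hm (by omega) (by omega)).mpr (by omega))
      ((oddQuarticAdj_sub_two hm (by omega) (by omega)).mpr (by omega)) fun y hy a b => ?_
    rw [oddQuarticAdj_sub_one hm hy (by omega)] at a
    rw [oddQuarticAdj_sub_two hm hy (by omega)] at b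
    exact Or.inl (by omega)
  have F := IsRelAut.fixed_insert F f7
  have f8 : s 3 = 3 := by
    refine H.fixed_of_adj (v := 2 * m - 1) (by omega) (by omega) f5
      ((oddQuarticAdj_sub_one hm (by omega) (by omega)).mpr (by omega)) fun y hy a => ?_
    rw [oddQuarticAdj_sub_one hm hy (by omega)] at a
    by_cases e : y = 3
    · exact Or.inl e
    · exact Or.inr (F y (by omega))
  have F := IsRelAut.fixed_insert F f8
  have f9 : s 4 = 4 := by
    refine H.fixed_of_adj (v := 2 * m - 2) (by omega) (by omega) f6
      ((oddQuarticAdj_sub_two hm (by omega) (by omega)).mpr (by omega)) fun y hy a => ?_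
    rw [oddQuarticAdj_sub_two hm hy (by omega)] at a
    by_cases e : y = 4
    · exact Or.inl e
    · exact Or.inr (F y (by omega))
  have F := IsRelAut.fixed_insert F f9
  have f10 : s (2 * m - 4) = 2 * m - 4 := by
    refine H.fixed_of_adj (v := 2) (by omega) (by omega) f2
      ((oddQuarticAdj_two hm (by omega)).mpr (by omega)) fun y hy a => ?_
    rw [oddQuarticAdj_two hm hy] at a
    by_cases e : y = 2 * m - 4
    · exact Or.inl e
    · exact Or.inr (F y (by omega))
  have F := IsRelAut.fixed_insert F f10
  have f11 : s 5 = 5 := by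
    refine H.fixed_of_adj (v := 2 * m - 3) (by omega) (by omega) f7
      ((oddQuarticAdj_sub_three hm (by omega) (by omega)).mpr (by omega)) fun y hy a => ?_
    rw [oddQuarticAdj_sub_three hm hy (by omega)] at a
    by_cases e : y = 5
    · exact Or.inl e
    · exact Or.inr (F y (by omega))
  have F := IsRelAut.fixed_insert F f11
  have f12 : s (2 * m - 5) = 2 * m - 5 := by
    refine H.fixed_of_adj (v := 3) (by omega) (by omega) f8
      ((oddQuarticAdj_generic hm (by omega) (by omega) (by omega) (by omega) (by omega)).mpr
        (by omega)) fun y hy a => ?_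
    rw [oddQuarticAdj_generic hm hy (by omega) (by omega) (by omega) (by omega)] at a
    by_cases e : y = 2 * m - 5
    · exact Or.inl e
    · exact Or.inr (F y (by omega))
  have F := IsRelAut.fixed_insert F f12
  intro x hx hx'
  exact F x (by omega)

theorem oddQuarticAdj_fixed {m : ℕ} (hm : 9 ≤ m) (hodd : m % 2 = 1) {s : ℕ → ℕ}
    (H : IsRelAut (2 * m) (oddQuarticAdj m) s) : ∀ x < 2 * m, s x = x := by
  -- Rungs have sum `2m - 2` and mirror edges sum `2m + 2`. So `k + 6` is the mirror partner of the
  -- fixed vertex `2m - 4 - k`, and `2m - 6 - k` the rung partner of `k + 4`; their other neighbours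
  -- are already fixed.
  have main : ∀ k, k + 6 ≤ m → ∀ x < 2 * m, (x ≤ k + 5 ∨ 2 * m ≤ x + k + 5) → s x = x := by
    intro k
    induction k with
    | zero => exact fun _ => oddQuarticAdj_fixed_base hm hodd H
    | succ k ih =>
      intro hk x hx h
      have ih := ih (by omega)
      by_cases h1 : x ≤ k + 5 ∨ 2 * m ≤ x + k + 5
      · exact ih x hx h1
      · rcases (by omega : x = k + 6 ∨ x + k + 6 = 2 * m) with rfl | hx'
        · refine H.fixed_of_adj (v := 2 * m - 4 - k) (by omega) hx (ih _ (by omega) (by omega))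
            ((oddQuarticAdj_generic hm (by omega) (by omega) (by omega) (by omega)
              (by omega)).mpr (by omega)) fun y hy h => ?_
          rw [oddQuarticAdj_generic hm hy (by omega) (by omega) (by omega) (by omega)] at h
          by_cases h3 : y = k + 6
          · exact Or.inl h3
          · exact Or.inr (ih y hy (by omega))
        · refine H.fixed_of_adj (v := k + 4) (by omega) hx (ih _ (by omega) (by omega))
            ((oddQuarticAdj_generic hm (by omega) (by omega) (by omega) (by omega)
              (by omega)).mpr (by omega)) fun y hy h => ?_
          rw [oddQuarticAdj_generic hm hy (by omega) (by omega) (by omega) (by omega)] at h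
          by_cases h3 : y = x
          · exact Or.inl h3
          · exact Or.inr (ih y hy (by omega))
  intro x hx
  by_cases c : x = m
  · exact c ▸ (oddQuarticAdj_fixed_seed hm hodd H).1
  · exact main (m - 6) (by omega) x hx (by omega)

/-! ### The families of regular asymmetric Hamiltonian graphs -/

theorem SimpleGraph.IsRegularAsymmetricHamiltonian.mk' {V : Type*} [Fintype V] [DecidableEq V]
    {G : SimpleGraph V} [G.LocallyFinite] {k : ℕ} (hreg : G.IsRegularOfDegree k)
    (hasym : G.IsAsymmetric) (hham : G.IsHamiltonian) : G.IsRegularAsymmetricHamiltonian k :=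
  ⟨by convert hreg, hasym, by convert hham⟩

theorem SimpleGraph.IsRegularAsymmetricHamiltonian.compl_fin {n k : ℕ} {G : SimpleGraph (Fin n)}
    (h : G.IsRegularAsymmetricHamiltonian k) (hn : 3 ≤ n) (hk : 2 * k + 2 ≤ n) :
    Gᶜ.IsRegularAsymmetricHamiltonian (n - (k + 1)) := by
  have := h.compl (by rwa [Fintype.card_fin]) (by rwa [Fintype.card_fin])
  rwa [Fintype.card_fin, Nat.sub_sub, add_comm 1 k] at this

theorem cubicGraph_isRegularAsymmetricHamiltonian {n : ℕ} (hn : 12 ≤ n) (heven : Even n) :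
    (cubicGraph n).IsRegularAsymmetricHamiltonian 3 := by
  obtain ⟨m, rfl⟩ := even_iff_two_dvd.mp heven
  classical
  exact .mk' (cubicGraph_isRegularOfDegree (by omega)) (cubicGraph_isAsymmetric (by omega))
    (cubicGraph_isHamiltonian (by omega))

theorem quarticGraph_isAsymmetric {n : ℕ} (hn : 12 ≤ n) (heven : Even n) :
    (quarticGraph n).IsAsymmetric := by
  obtain ⟨m, rfl⟩ := even_iff_two_dvd.mp heven
  rcases Nat.even_or_odd m with hm | hm
  · obtain ⟨h, rfl⟩ := even_iff_two_dvd.mp hm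
    by_cases h3 : h = 3
    · subst h3
      exact quarticGraph_twelve_isAsymmetric
    · rw [← mul_assoc]
      exact SimpleGraph.isAsymmetric_of_isRelAut (quarticGraph_adj_of_even (h := h) (by omega))
        fun _ H => evenQuarticAdj_fixed (by omega) H
  · have hodd := Nat.odd_iff.mp hm
    by_cases h7 : m = 7
    · subst h7
      exact quarticGraph_fourteen_isAsymmetric
    · exact SimpleGraph.isAsymmetric_of_isRelAut (quarticGraph_adj_of_odd (by omega) hodd)
        fun _ H => oddQuarticAdj_fixed (by omega) hodd H

theorem quarticGraph_isRegularAsymmetricHamiltonian {n : ℕ} (hn : 12 ≤ n) (heven : Even n) :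
    (quarticGraph n).IsRegularAsymmetricHamiltonian 4 := by
  classical
  refine .mk' ?_ (quarticGraph_isAsymmetric hn heven) (quarticGraph_isHamiltonian (by omega))
  obtain ⟨m, rfl⟩ := even_iff_two_dvd.mp heven
  rcases Nat.even_or_odd m with hm | hm
  · obtain ⟨h, rfl⟩ := even_iff_two_dvd.mp hm
    rw [← mul_assoc]
    exact quarticGraph_isRegularOfDegree (by ring) (by omega)
      (quarticGraph_adj_of_even (h := h) (by omega))
      fun x hx => exists_evenExtraAdj_iff (by omega) hx
  · have hodd := Nat.odd_iff.mp hm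
    exact quarticGraph_isRegularOfDegree rfl (by omega)
      (quarticGraph_adj_of_odd (by omega) hodd)
      fun x hx => exists_oddExtraAdj_iff (by omega) hodd hx

/-- Adjacency in the quintic graph on twelve vertices: the quartic graph and a perfect matching. -/
def quinticAdj (x y : Fin 12) : Prop :=
  evenQuarticAdj 3 x y ∨
    (x, y) ∈ [((0 : Fin 12), (2 : Fin 12)), (1, 4), (3, 5), (6, 10), (7, 9), (8, 11)] ∨
    (y, x) ∈ [((0 : Fin 12), (2 : Fin 12)), (1, 4), (3, 5), (6, 10), (7, 9), (8, 11)]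

instance : DecidableRel quinticAdj := fun _ _ => by unfold quinticAdj; infer_instance

/-- A quintic graph on twelve vertices. -/
def quinticGraph : SimpleGraph (Fin 12) := SimpleGraph.fromRel quinticAdj

theorem quinticGraph_adj (x y : Fin 12) : quinticGraph.Adj x y ↔ quinticAdj x y := by
  rw [quinticGraph, SimpleGraph.fromRel_adj]
  revert x y
  decide +kernel

theorem quinticGraph_isRegularAsymmetricHamiltonian :
    quinticGraph.IsRegularAsymmetricHamiltonian 5 := by
  classical
  have hadj : ∀ v w, quinticGraph.Adj v w ↔ w ∈ Finset.univ.filter fun w => quinticAdj v w := by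
    intro v w
    rw [quinticGraph_adj]
    simp
  refine .mk' (fun v => ?_) ?_ ?_
  · rw [SimpleGraph.degree_eq_of_adj_iff _ (hadj v)]
    revert v
    decide +kernel
  · exact SimpleGraph.IsAsymmetric.of_refinedColour_injective _ hadj 2 (by decide +kernel)
  -- The quintic graph contains the quartic one, hence its Hamiltonian cycle.
  · refine (quarticGraph_isHamiltonian (n := 12) (by norm_num)).mono fun x y hxy => ?_
    rw [quinticGraph_adj]
    exact Or.inl ((quarticGraph_adj_of_even (h := 3) le_rfl x y).mp hxy)

theorem mainTheorem1 :
    -- for every `k ≥ 3` there is a `k`-regular asymmetric Hamiltonian graph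
    (∀ k : ℕ, 3 ≤ k → ∃ (n : ℕ) (G : SimpleGraph (Fin n)),
      G.IsRegularAsymmetricHamiltonian k) ∧
    -- the cubic and quartic families, and their complements
    (∀ n : ℕ, 12 ≤ n → Even n →
      (cubicGraph n).IsRegularAsymmetricHamiltonian 3 ∧
      (quarticGraph n).IsRegularAsymmetricHamiltonian 4 ∧
      (cubicGraph n)ᶜ.IsRegularAsymmetricHamiltonian (n - 4) ∧
      (quarticGraph n)ᶜ.IsRegularAsymmetricHamiltonian (n - 5)) ∧
    -- complements of arbitrary cubic and quartic asymmetric Hamiltonian graphs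
    (∀ (n : ℕ) (G : SimpleGraph (Fin n)), 8 ≤ n →
      G.IsRegularAsymmetricHamiltonian 3 → Gᶜ.IsRegularAsymmetricHamiltonian (n - 4)) ∧
    (∀ (n : ℕ) (G : SimpleGraph (Fin n)), 10 ≤ n →
      G.IsRegularAsymmetricHamiltonian 4 → Gᶜ.IsRegularAsymmetricHamiltonian (n - 5)) ∧
    -- a 5-regular graph on 12 vertices with its 6-regular complement
    (∃ G : SimpleGraph (Fin 12),
      G.IsRegularAsymmetricHamiltonian 5 ∧ Gᶜ.IsRegularAsymmetricHamiltonian 6) := by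
  have quintic_compl := quinticGraph_isRegularAsymmetricHamiltonian.compl_fin (by norm_num)
    (by norm_num)
  refine ⟨fun k hk => ?_, fun n hn heven => ?_, fun n G hn h => h.compl_fin (by omega) (by omega),
    fun n G hn h => h.compl_fin (by omega) (by omega),
    quinticGraph, quinticGraph_isRegularAsymmetricHamiltonian, quintic_compl⟩
  · rcases (by omega : k = 3 ∨ k = 4 ∨ k = 5 ∨ k = 6 ∨ 7 ≤ k) with rfl | rfl | rfl | rfl | h
    · exact ⟨12, _, cubicGraph_isRegularAsymmetricHamiltonian le_rfl (by decide)⟩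
    · exact ⟨12, _, quarticGraph_isRegularAsymmetricHamiltonian le_rfl (by decide)⟩
    · exact ⟨12, _, quinticGraph_isRegularAsymmetricHamiltonian⟩
    · exact ⟨12, _, quintic_compl⟩
    · rcases Nat.even_or_odd k with hk' | hk'
      · have hn : Even (k + 4) := hk'.add (by decide)
        -- Parity improves `7 ≤ k` to `8 ≤ k`, so that `k + 4 ≥ 12`.
        have := Nat.even_iff.mp hk'
        exact ⟨k + 4, _, (cubicGraph_isRegularAsymmetricHamiltonian (by omega) hn).compl_fin
          (by omega) (by omega)⟩
      · have hn : Even (k + 5) := hk'.add_odd (by decide)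
        exact ⟨k + 5, _, (quarticGraph_isRegularAsymmetricHamiltonian (by omega) hn).compl_fin
          (by omega) (by omega)⟩
  · have h3 := cubicGraph_isRegularAsymmetricHamiltonian hn heven
    have h4 := quarticGraph_isRegularAsymmetricHamiltonian hn heven
    exact ⟨h3, h4, h3.compl_fin (by omega) (by omega), h4.compl_fin (by omega) (by omega)⟩
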